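/- Let $q$ be a prime power, let $K$ be a finite extension of $\mathbb{F}_q(t)$, and let $P$ be a place of $K$, with normalized valuation $v_P$. Let $K_P$ be the completion of $K$ at $P$, $R_P$ its valuation ring, $\pi_P$ a uniformizer of $R_P$, and $Q_P=|R_P/\pi_PR_P|$. Let $\mu_P$ be the Haar measure on $K_P^5$ with $\mu_P(R_P^5)=1$, and identify a vector $(a_1,a_2,a_3,a_4,a_6)\in R_P^5$ with the curve $$E:\ y^2+a_1xy+a_3y=x^3+a_2x^2+a_4x+a_6 .$$ For an elliptic curve $E$ (one with $\Delta(E)\neq 0$) with coefficients in $R_P$, let $N_P(E)$ be the number of iterations that Tate's algorithm completes when it is applied to $E$, that is, the number of times that it finds the current equation to be nonminimal and restarts with the coefficients $a_i/\pi_P^i$. The Kodaira type of $E$ is the type with which the algorithm stops. The Tamagawa number of $E$ is the index $[E(K_P):E_0(K_P)]$, where $E_0(K_P)$ is the set of points with nonsingular reduction on a minimal Weierstrass equation of $E$. For a Kodaira type $\mathfrak r$, a positive integer $n$ and an integer $k\ge 0$, let $U_k\subseteq R_P^5$ be the set of elliptic curves $E$ with coefficients in $R_P$ that have Kodaira type $\mathfrak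 r$, Tamagawa number $n$ and $N_P(E)=k$, and let $\delta_K(\mathfrak r,n,k;P)=\mu_P(U_k)$. Then, for all $\mathfrak r$, $n$ and $k$, the set $U_k$ is measurable and $$\delta_K(\mathfrak r,n,k;P)=\frac{1}{Q_P^{10k}}\,\delta_K(\mathfrak r,n,0;P).$$ -/

import Mathlib

open scoped WithZero ENNReal Valued

/-- The Kodaira types; `I n` is `I_n` and `Istar n` is `I_n^*` (with `n = 0` allowed). -/
inductive KodairaType : Type
  | I (n : ℕ)
  | II
  | III
  | IV
  | Istar (n : ℕ)
  | IVstar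
  | IIIstar
  | IIstar

namespace TateAlg

section Algorithm

variable {R : Type*} [CommRing R]

/-- `W'` is obtained from `W` by replacing `x` with `x + n` and `y` with `y + l x + m`
for some `l, m, n` in `R`. -/
def IsTranslate (W W' : WeierstrassCurve R) : Prop :=
  ∃ T : WeierstrassCurve.VariableChange R, T.u = 1 ∧ W' = T • W

/-- `π ^ eᵢ` divides `aᵢ` for `i = 1, 2, 3, 4, 6`. -/
def DivBy (π : R) (e₁ e₂ e₃ e₄ e₆ : ℕ) (W : WeierstrassCurve R) : Prop :=
  π ^ e₁ ∣ W.a₁ ∧ π ^ e₂ ∣ W.a₂ ∧ π ^ e₃ ∣ W.a₃ ∧ π ^ e₄ ∣ W.a₄ ∧ π ^ e₆ ∣ W.a₆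

/-- The coefficients of `W` are `aᵢ = π ^ i aᵢ'`, where the `aᵢ'` are the coefficients of `W'`. -/
def IsRescaling (π : R) (W W' : WeierstrassCurve R) : Prop :=
  W.a₁ = π * W'.a₁ ∧ W.a₂ = π ^ 2 * W'.a₂ ∧ W.a₃ = π ^ 3 * W'.a₃ ∧
    W.a₄ = π ^ 4 * W'.a₄ ∧ W.a₆ = π ^ 6 * W'.a₆

variable [IsLocalRing R]

/-- `P` is the cubic `T³ + (a₂/π) T² + (a₄/π²) T + a₆/π³` over the residue field. -/
def IsCubic (π : R) (W : WeierstrassCurve R)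
    (P : Polynomial (IsLocalRing.ResidueField R)) : Prop :=
  ∃ c₂ c₄ c₆ : R, W.a₂ = π * c₂ ∧ W.a₄ = π ^ 2 * c₄ ∧ W.a₆ = π ^ 3 * c₆ ∧
    P = Polynomial.X ^ 3 + Polynomial.C (IsLocalRing.residue R c₂) * Polynomial.X ^ 2
      + Polynomial.C (IsLocalRing.residue R c₄) * Polynomial.X
      + Polynomial.C (IsLocalRing.residue R c₆)

/-- `Q` is the quadratic `Y² + (a₃/π^i) Y - a₆/π^(2i)` over the residue field. -/
def IsQuadY (π : R) (i : ℕ) (W : WeierstrassCurve R)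
    (Q : Polynomial (IsLocalRing.ResidueField R)) : Prop :=
  ∃ c₃ c₆ : R, W.a₃ = π ^ i * c₃ ∧ W.a₆ = π ^ (2 * i) * c₆ ∧
    Q = Polynomial.X ^ 2 + Polynomial.C (IsLocalRing.residue R c₃) * Polynomial.X
      - Polynomial.C (IsLocalRing.residue R c₆)

/-- `Q` is the quadratic `(a₂/π) X² + (a₄/π^(j+3)) X + a₆/π^(2j+5)` over the residue field. -/
def IsQuadX (π : R) (j : ℕ) (W : WeierstrassCurve R)
    (Q : Polynomial (IsLocalRing.ResidueField R)) : Prop :=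
  ∃ c₂ c₄ c₆ : R, W.a₂ = π * c₂ ∧ W.a₄ = π ^ (j + 3) * c₄ ∧ W.a₆ = π ^ (2 * j + 5) * c₆ ∧
    Q = Polynomial.C (IsLocalRing.residue R c₂) * Polynomial.X ^ 2
      + Polynomial.C (IsLocalRing.residue R c₄) * Polynomial.X
      + Polynomial.C (IsLocalRing.residue R c₆)

/-- The steps of Tate's algorithm. `step7Y j` and `step7X j` are the rounds of the subprocedure of
step 7 that test for the types `I_(2j+1)^*` and `I_(2j+2)^*`. -/
inductive Stage : Type
  | step1
  | step2
  | step3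
  | step4
  | step5
  | step6
  | step7Y (j : ℕ)
  | step7X (j : ℕ)
  | step8
  | step9
  | step10
  | step11

/-- `Reaches π W s V k`: Tate's algorithm, started with the integral equation `W`, gets to the
beginning of step `s` with the current equation `V`, after `k` completed iterations.
A step whose stopping condition fails hands over to the next one, after the change of coordinates
that it prescribes. -/
inductive Reaches (π : R) (W : WeierstrassCurve R) : Stage → WeierstrassCurve R → ℕ → Prop
  | start : Reaches π W .step1 W 0
  /-- The reduction is singular, and the singular point is moved to `(0, 0)`. -/
  | to2 {V V' : WeierstrassCurve R} {k : ℕ} (h : Reaches π W .step1 V k) (hd : π ∣ V.Δ)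
      (ht : IsTranslate V V') (hV : DivBy π 0 0 1 1 1 V') : Reaches π W .step2 V' k
  | to3 {V : WeierstrassCurve R} {k : ℕ} (h : Reaches π W .step2 V k) (hd : π ∣ V.b₂) :
      Reaches π W .step3 V k
  | to4 {V : WeierstrassCurve R} {k : ℕ} (h : Reaches π W .step3 V k) (hd : π ^ 2 ∣ V.a₆) :
      Reaches π W .step4 V k
  | to5 {V : WeierstrassCurve R} {k : ℕ} (h : Reaches π W .step4 V k) (hd : π ^ 3 ∣ V.b₈) :
      Reaches π W .step5 V k
  | to6 {V V' : WeierstrassCurve R} {k : ℕ} (h : Reaches π W .step5 V k) (hd : π ^ 3 ∣ V.b₆)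
      (ht : IsTranslate V V') (hV : DivBy π 1 1 2 2 3 V') : Reaches π W .step6 V' k
  /-- The cubic has a double root and a simple root, and the double root is moved to `0`. -/
  | to7 {V V' : WeierstrassCurve R} {k : ℕ} (h : Reaches π W .step6 V k)
      (hd : ∃ ρ σ : IsLocalRing.ResidueField R, ρ ≠ σ ∧
        IsCubic π V ((Polynomial.X - Polynomial.C ρ) ^ 2 * (Polynomial.X - Polynomial.C σ)))
      (ht : IsTranslate V V') (hV : DivBy π 1 1 2 3 4 V') : Reaches π W (.step7Y 0) V' k
  /-- The quadratic in `Y` has a double root, which is moved to `0`. -/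
  | to7X {V V' : WeierstrassCurve R} {k j : ℕ} (h : Reaches π W (.step7Y j) V k)
      (hd : ∃ Q, IsQuadY π (j + 2) V Q ∧ ¬ Q.Separable)
      (ht : IsTranslate V V') (hV : DivBy π 1 1 (j + 3) (j + 3) (2 * j + 5) V') :
      Reaches π W (.step7X j) V' k
  /-- The quadratic in `X` has a double root, which is moved to `0`. -/
  | to7Y {V V' : WeierstrassCurve R} {k j : ℕ} (h : Reaches π W (.step7X j) V k)
      (hd : ∃ Q, IsQuadX π j V Q ∧ ¬ Q.Separable)
      (ht : IsTranslate V V') (hV : DivBy π 1 1 (j + 3) (j + 4) (2 * j + 6) V') :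
      Reaches π W (.step7Y (j + 1)) V' k
  /-- The cubic has a triple root, which is moved to `0`. -/
  | to8 {V V' : WeierstrassCurve R} {k : ℕ} (h : Reaches π W .step6 V k)
      (hd : ∃ ρ : IsLocalRing.ResidueField R, IsCubic π V ((Polynomial.X - Polynomial.C ρ) ^ 3))
      (ht : IsTranslate V V') (hV : DivBy π 1 2 2 3 4 V') : Reaches π W .step8 V' k
  /-- The quadratic in `Y` has a double root, which is moved to `0`. -/
  | to9 {V V' : WeierstrassCurve R} {k : ℕ} (h : Reaches π W .step8 V k)
      (hd : ∃ Q, IsQuadY π 2 V Q ∧ ¬ Q.Separable)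
      (ht : IsTranslate V V') (hV : DivBy π 1 2 3 3 5 V') : Reaches π W .step9 V' k
  | to10 {V : WeierstrassCurve R} {k : ℕ} (h : Reaches π W .step9 V k) (hd : π ^ 4 ∣ V.a₄) :
      Reaches π W .step10 V k
  | to11 {V : WeierstrassCurve R} {k : ℕ} (h : Reaches π W .step10 V k) (hd : π ^ 6 ∣ V.a₆) :
      Reaches π W .step11 V k
  /-- The equation is not minimal: the iteration is completed, and the algorithm starts again with
  the coefficients `aᵢ / π ^ i`. -/
  | again {V V' : WeierstrassCurve R} {k : ℕ} (h : Reaches π W .step11 V k)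
      (hV : IsRescaling π V V') : Reaches π W .step1 V' (k + 1)

/-- `TateOutput π W r k`: Tate's algorithm, started with the integral equation `W`, completes
exactly `k` iterations and then stops with the Kodaira type `r`. -/
inductive TateOutput (π : R) (W : WeierstrassCurve R) : KodairaType → ℕ → Prop
  | I_zero {V : WeierstrassCurve R} {k : ℕ} (h : Reaches π W .step1 V k) (hd : ¬ π ∣ V.Δ) :
      TateOutput π W (.I 0) k
  | I_pos {V : WeierstrassCurve R} {k n : ℕ} (h : Reaches π W .step2 V k) (hd : ¬ π ∣ V.b₂)
      (hn : π ^ n ∣ V.Δ) (hn' : ¬ π ^ (n + 1) ∣ V.Δ) : TateOutput π W (.I n) k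
  | II {V : WeierstrassCurve R} {k : ℕ} (h : Reaches π W .step3 V k) (hd : ¬ π ^ 2 ∣ V.a₆) :
      TateOutput π W .II k
  | III {V : WeierstrassCurve R} {k : ℕ} (h : Reaches π W .step4 V k) (hd : ¬ π ^ 3 ∣ V.b₈) :
      TateOutput π W .III k
  | IV {V : WeierstrassCurve R} {k : ℕ} (h : Reaches π W .step5 V k) (hd : ¬ π ^ 3 ∣ V.b₆) :
      TateOutput π W .IV k
  | Istar_zero {V : WeierstrassCurve R} {k : ℕ} (h : Reaches π W .step6 V k)
      (hd : ∃ P, IsCubic π V P ∧ P.Separable) : TateOutput π W (.Istar 0) k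
  | Istar_odd {V : WeierstrassCurve R} {k j : ℕ} (h : Reaches π W (.step7Y j) V k)
      (hd : ∃ Q, IsQuadY π (j + 2) V Q ∧ Q.Separable) : TateOutput π W (.Istar (2 * j + 1)) k
  | Istar_even {V : WeierstrassCurve R} {k j : ℕ} (h : Reaches π W (.step7X j) V k)
      (hd : ∃ Q, IsQuadX π j V Q ∧ Q.Separable) : TateOutput π W (.Istar (2 * j + 2)) k
  | IVstar {V : WeierstrassCurve R} {k : ℕ} (h : Reaches π W .step8 V k)
      (hd : ∃ Q, IsQuadY π 2 V Q ∧ Q.Separable) : TateOutput π W .IVstar k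
  | IIIstar {V : WeierstrassCurve R} {k : ℕ} (h : Reaches π W .step9 V k) (hd : ¬ π ^ 4 ∣ V.a₄) :
      TateOutput π W .IIIstar k
  | IIstar {V : WeierstrassCurve R} {k : ℕ} (h : Reaches π W .step10 V k) (hd : ¬ π ^ 6 ∣ V.a₆) :
      TateOutput π W .IIstar k

end Algorithm

section Tamagawa

variable {L Γ : Type*} [Field L] [LinearOrderedCommGroupWithZero Γ] [Valued L Γ]

/-- The coefficients of `W` lie in the valuation ring. -/
def IsIntegralEq (W : WeierstrassCurve L) : Prop :=
  ∃ W₀ : WeierstrassCurve 𝒪[L], W₀.map (Valued.integer L).subtype = W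

/-- `W` is integral, and no equivalent integral equation has a discriminant of smaller additive
valuation (that is, of larger multiplicative valuation). -/
def IsMinimalEq (W : WeierstrassCurve L) : Prop :=
  IsIntegralEq W ∧ ∀ T : WeierstrassCurve.VariableChange L, IsIntegralEq (T • W) →
    Valued.v (T • W).Δ ≤ Valued.v W.Δ

/-- The point has integral coordinates, and both partial derivatives of the equation
vanish at its reduction. -/
def HasSingularReduction (W : WeierstrassCurve L) : W.toAffine.Point → Prop
  | .zero => False
  | .some x y _ => Valued.v x ≤ 1 ∧ Valued.v y ≤ 1 ∧
      Valued.v (W.a₁ * y - (3 * x ^ 2 + 2 * W.a₂ * x + W.a₄)) < 1 ∧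
      Valued.v (2 * y + W.a₁ * x + W.a₃) < 1

/-- `E₀(L)`: the points of the integral equation `W` with nonsingular reduction. -/
def nonsingularReduction (W : WeierstrassCurve L) : Set W.toAffine.Point :=
  {P | ¬ HasSingularReduction W P}

open Classical in
/-- The index `[E(L) : E₀(L)]`: the number of cosets of `E₀(L)` in `E(L)`. -/
noncomputable def indexE₀ (W : WeierstrassCurve L) : ℕ :=
  (Set.range fun P : W.toAffine.Point => (fun Q => P + Q) '' nonsingularReduction W).ncard

/-- The Tamagawa number of `W` is `n`: it is the index `[E(L) : E₀(L)]`, where `E₀(L)` is taken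
with respect to a minimal equation equivalent to `W`. -/
def HasTamagawaNumber (W : WeierstrassCurve L) (n : ℕ) : Prop :=
  ∃ T : WeierstrassCurve.VariableChange L, IsMinimalEq (T • W) ∧ indexE₀ (T • W) = n

/-- The set of coefficient vectors `(a₁, a₂, a₃, a₄, a₆)` of the elliptic curves with integral
coefficients that have Kodaira type `r` and Tamagawa number `n`, and for which Tate's algorithm
completes exactly `k` iterations. -/
def curveSet (π : 𝒪[L]) (r : KodairaType) (n k : ℕ) : Set (Fin 5 → L) :=
  {a | ∃ W : WeierstrassCurve 𝒪[L],
    a = ![(W.a₁ : L), (W.a₂ : L), (W.a₃ : L), (W.a₄ : L), (W.a₆ : L)] ∧ W.Δ ≠ 0 ∧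
    TateOutput π W r k ∧ HasTamagawaNumber (W.map (Valued.integer L).subtype) n}

end Tamagawa

end TateAlg

/-!
An equation on which Tate's algorithm completes at least one iteration is exactly one that has a
translate with `π ^ i ∣ aᵢ`, and the first iteration replaces it with the rescaled translate
(`tateOutput_succ_iff`): such a translate passes through all the steps, because every polynomial
that the algorithm looks at has `0` as its only root, and the outcome does not change under
translation. Neither translations nor the rescaling change the Tamagawa number. Hence `U_{k+1}` is
the set of curves that some translation followed by the rescaling carries into `U_k`.

The translation is unique up to the translations `(r, s, t)` of the rescaled equation, which are
the translations `(π² r, π s, π³ t)` of the original one: an isomorphism between two integral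
equations whose scaling is a unit is integral, since `r`, `s` and `t` satisfy equations with
integral coefficients and unit leading coefficient (`mem_integer_of_isIntegralEq`). With `Q` the
order of the residue field there are `Q ^ (2 + 1 + 3)` classes of translations, so `U_{k+1}` is the
disjoint union of `Q ^ 6` sets, each the preimage of `U_k` under a translation followed by the
rescaling (`curveSet_succ`, `pairwise_disjoint_preimage_curveSet`). A translation acts on
coefficient vectors by an affine map with integral unipotent linear part, which preserves the
measure, and the rescaling divides the coordinates by `π`, `π²`, `π³`, `π⁴`, `π⁶`, so a preimage
under it has `Q ^ (-16)` times the measure. Therefore `μ U_{k+1} = Q ^ (6 - 16) μ U_k`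
(`measure_curveSet_succ`).

For measurability, `K_P` is sigma-compact and locally compact, so sigma-compact subsets of its
powers are closed under finite intersections, countable unions and projections. The conditions of
the algorithm are closed ones, with quantifiers only over the compact valuation ring and over `ℕ`,
so the curves with a given outcome form a sigma-compact set (`isSigmaCompact_setOf_tateOutput`).
Having at least `n` cosets of `E₀(K_P)` is also a sigma-compact condition, because distinctness of
cosets can be witnessed by points (`isSigmaCompact_setOf_hasCosets`), and so is having an equivalent
integral equation with discriminant of a given valuation. The Tamagawa number is a Boolean
combination of countably many such conditions (`hasTamagawaNumber_iff`).

The residue field is finite because the valuation ring has finite Haar measure and its residue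
classes have equal positive measure (`finite_residueField_of_measure_ne_top`); this makes the
completion locally compact.
-/

/-! ### Sigma-compact sets -/

section SigmaCompact

variable {Y Z : Type*} [TopologicalSpace Y] [TopologicalSpace Z]

theorem IsClosed.isSigmaCompact' [SigmaCompactSpace Z] {s : Set Z} (hs : IsClosed s) :
    IsSigmaCompact s :=
  isSigmaCompact_univ.of_isClosed_subset hs (Set.subset_univ s)

theorem IsOpen.isSigmaCompact [LocallyCompactSpace Z] [SecondCountableTopology Z] [T2Space Z]
    {s : Set Z} (hs : IsOpen s) : IsSigmaCompact s := by
  have := hs.locallyCompactSpace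
  exact isSigmaCompact_iff_sigmaCompactSpace.mpr inferInstance

theorem IsSigmaCompact.setOf_and [T2Space Z] {p q : Z → Prop} (hp : IsSigmaCompact {z | p z})
    (hq : IsSigmaCompact {z | q z}) : IsSigmaCompact {z | p z ∧ q z} := by
  obtain ⟨A, hA, hA'⟩ := hp
  obtain ⟨B, hB, hB'⟩ := hq
  have h : {z | p z ∧ q z} = ⋃ i : ℕ × ℕ, A i.1 ∩ B i.2 := by
    change {z | p z} ∩ {z | q z} = _
    rw [← hA', ← hB', Set.iUnion_inter_iUnion, Set.iUnion_prod']
  rw [h]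
  exact isSigmaCompact_iUnion_of_isCompact _ fun i => (hA i.1).inter (hB i.2)

theorem IsSigmaCompact.setOf_exists_of_countable {ι : Sort*} [Countable ι] {p : ι → Z → Prop}
    (h : ∀ i, IsSigmaCompact {z | p i z}) : IsSigmaCompact {z | ∃ i, p i z} := by
  rw [Set.ofPred_exists]
  choose A hA hA' using h
  have h : (⋃ i, {z | p i z}) = ⋃ x : PLift ι × ℕ, A x.1.down x.2 := by
    ext z
    simp only [← hA', Set.mem_iUnion, Prod.exists, PLift.exists]
  rw [h]
  exact isSigmaCompact_iUnion_of_isCompact _ fun x => hA x.1.down x.2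

theorem IsSigmaCompact.setOf_or {p q : Z → Prop} (hp : IsSigmaCompact {z | p z})
    (hq : IsSigmaCompact {z | q z}) : IsSigmaCompact {z | p z ∨ q z} := by
  have h : {z | p z ∨ q z} = {z | ∃ b : Bool, if b then p z else q z} := by
    ext z
    simp [or_comm]
  rw [h]
  exact .setOf_exists_of_countable fun b => by cases b <;> simpa

theorem IsSigmaCompact.setOf_forall [T2Space Z] [SigmaCompactSpace Z] {ι : Type*} [Finite ι]
    {p : ι → Z → Prop} (h : ∀ i, IsSigmaCompact {z | p i z}) : IsSigmaCompact {z | ∀ i, p i z} := by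
  classical
  have := Fintype.ofFinite ι
  have key : ∀ s : Finset ι, IsSigmaCompact {z | ∀ i ∈ s, p i z} := by
    intro s
    induction s using Finset.induction_on with
    | empty => simpa using isSigmaCompact_univ
    | insert i s _ ih => simpa using (h i).setOf_and ih
  simpa using key Finset.univ

/-- Projections of sigma-compact sets are sigma-compact. -/
theorem IsSigmaCompact.setOf_exists {p : Z → Y → Prop}
    (h : IsSigmaCompact {x : Z × Y | p x.1 x.2}) : IsSigmaCompact {z | ∃ y, p z y} := by
  convert h.image continuous_fst using 1
  ext z
  simp

theorem IsSigmaCompact.preimage' [SigmaCompactSpace Z] [T2Space Y] {s : Set Y}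
    (hs : IsSigmaCompact s) {f : Z → Y} (hf : Continuous f) : IsSigmaCompact (f ⁻¹' s) := by
  obtain ⟨A, hA, rfl⟩ := hs
  rw [Set.preimage_iUnion]
  exact isSigmaCompact_iUnion _ fun i => ((hA i).isClosed.preimage hf).isSigmaCompact'

theorem IsSigmaCompact.measurableSet [T2Space Z] [MeasurableSpace Z] [OpensMeasurableSpace Z]
    {s : Set Z} (hs : IsSigmaCompact s) : MeasurableSet s := by
  obtain ⟨A, hA, rfl⟩ := hs
  exact .iUnion fun i => (hA i).measurableSet

/-- Composition of two relations through a middle variable. -/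
theorem IsSigmaCompact.relComp {X : Type*} [TopologicalSpace X] [SigmaCompactSpace X]
    [SigmaCompactSpace Y] [SigmaCompactSpace Z] [T2Space X] [T2Space Y] [T2Space Z]
    {p : X → Y → Prop} {q : Y → Z → Prop}
    (hp : IsSigmaCompact {x : X × Y | p x.1 x.2}) (hq : IsSigmaCompact {x : Y × Z | q x.1 x.2}) :
    IsSigmaCompact {x : X × Z | ∃ y, p x.1 y ∧ q y x.2} :=
  .setOf_exists (.setOf_and
    (hp.preimage' (f := fun x : (X × Z) × Y => (x.1.1, x.2)) (by fun_prop))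
    (hq.preimage' (f := fun x : (X × Z) × Y => (x.2, x.1.2)) (by fun_prop)))

end SigmaCompact

/-! ### Topology of a complete discretely valued field -/

instance : Countable ℤᵐ⁰ := inferInstanceAs (Countable (Option ℤ))

namespace TateAlg

section ValuedField

variable {L : Type*} [Field L]

theorem isClopen_setOf_v_le {Γ : Type*} [LinearOrderedCommGroupWithZero Γ] [hv : Valued L Γ]
    {c : L} (hc : c ≠ 0) : IsClopen {x : L | hv.v x ≤ hv.v c} := by
  simpa only [Valuation.restrict_le_iff] using
    Valued.isClopen_closedBall L (r := hv.v.restrict c) (by simpa using hc)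

theorem isClopen_setOf_v_lt {Γ : Type*} [LinearOrderedCommGroupWithZero Γ] [hv : Valued L Γ]
    (c : L) : IsClopen {x : L | hv.v x < hv.v c} := by
  simpa only [Valuation.restrict_lt_iff] using Valued.isClopen_ball L (r := hv.v.restrict c)

theorem isClopen_setOf_v_eq {Γ : Type*} [LinearOrderedCommGroupWithZero Γ] [hv : Valued L Γ]
    {c : L} (hc : c ≠ 0) : IsClopen {x : L | hv.v x = hv.v c} := by
  convert (isClopen_setOf_v_le hc).diff (isClopen_setOf_v_lt c) using 1
  ext x
  simp [le_antisymm_iff]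

variable [hv : Valued L ℤᵐ⁰]

theorem isRankOneDiscrete_of_isNontrivial [hv.v.IsNontrivial] : hv.v.IsRankOneDiscrete := by
  have : IsCyclic (ℤᵐ⁰)ˣ :=
    (WithZero.unitsWithZeroEquiv (α := Multiplicative ℤ)).isCyclic.mpr inferInstance
  infer_instance

theorem isDiscreteValuationRing_integer [hv.v.IsNontrivial] : IsDiscreteValuationRing 𝒪[L] := by
  have := isRankOneDiscrete_of_isNontrivial (L := L)
  exact inferInstanceAs (IsDiscreteValuationRing hv.v.valuationSubring)

/-- A complete discretely valued field with finite residue field is a proper metric space. -/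
theorem locallyCompact_of_finite_residueField [CompleteSpace L] [IsDiscreteValuationRing 𝒪[L]]
    [Finite 𝓀[L]] [hv.v.IsNontrivial] :
    SecondCountableTopology L ∧ LocallyCompactSpace L ∧ CompactSpace 𝒪[L] := by
  have := isRankOneDiscrete_of_isNontrivial (L := L)
  let : hv.v.RankOne := Valuation.IsRankOneDiscrete.rankOne hv.v (e := 2) (by norm_num)
  let := Valued.toNormedField L ℤᵐ⁰
  have h : ProperSpace L := by
    rw [Valued.integer.properSpace_iff_completeSpace_and_isDiscreteValuationRing_integer_and_finite_residueField]
    exact ⟨inferInstance, inferInstance, inferInstance⟩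
  exact ⟨inferInstance, inferInstance, Valued.integer.properSpace_iff_compactSpace_integer.mp h⟩

end ValuedField

/-! ### The space of Weierstrass equations -/

section Coefficients

variable {R : Type*}

/-- The Weierstrass equation with the coefficient vector `(a₁, a₂, a₃, a₄, a₆)`. -/
def ofCoeffs (a : Fin 5 → R) : WeierstrassCurve R := ⟨a 0, a 1, a 2, a 3, a 4⟩

/-- The coefficient vector `(a₁, a₂, a₃, a₄, a₆)` of a Weierstrass equation. -/
def coeffs (W : WeierstrassCurve R) : Fin 5 → R := ![W.a₁, W.a₂, W.a₃, W.a₄, W.a₆]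

theorem ofCoeffs_coeffs (W : WeierstrassCurve R) : ofCoeffs (coeffs W) = W := rfl

theorem coeffs_ofCoeffs (a : Fin 5 → R) : coeffs (ofCoeffs a) = a := by
  ext i
  fin_cases i <;> rfl

variable [TopologicalSpace R]

/-- Weierstrass equations carry the product topology of their coefficients. -/
instance : TopologicalSpace (WeierstrassCurve R) := .induced coeffs inferInstance

/-- The space of Weierstrass equations is the space of coefficient vectors. -/
def coeffsHomeomorph : WeierstrassCurve R ≃ₜ (Fin 5 → R) where
  toFun := coeffs
  invFun := ofCoeffs
  left_inv := ofCoeffs_coeffs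
  right_inv := coeffs_ofCoeffs
  continuous_toFun := continuous_induced_dom
  continuous_invFun := continuous_induced_rng.mpr (by
    convert continuous_id using 1
    exact funext coeffs_ofCoeffs)

instance [T2Space R] : T2Space (WeierstrassCurve R) := coeffsHomeomorph.symm.t2Space

instance [SecondCountableTopology R] : SecondCountableTopology (WeierstrassCurve R) :=
  coeffsHomeomorph.secondCountableTopology

instance [SigmaCompactSpace R] : SigmaCompactSpace (WeierstrassCurve R) :=
  coeffsHomeomorph.isClosedEmbedding.sigmaCompactSpace

instance [LocallyCompactSpace R] : LocallyCompactSpace (WeierstrassCurve R) :=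
  coeffsHomeomorph.isClosedEmbedding.locallyCompactSpace

@[fun_prop]
theorem continuous_ofCoeffs : Continuous (ofCoeffs : (Fin 5 → R) → WeierstrassCurve R) :=
  coeffsHomeomorph.symm.continuous

theorem continuous_coeffs_apply (i : Fin 5) : Continuous fun W : WeierstrassCurve R => coeffs W i :=
  (continuous_apply i).comp coeffsHomeomorph.continuous

variable {Z : Type*} [TopologicalSpace Z] {W : Z → WeierstrassCurve R}

@[fun_prop]
theorem continuous_a₁ (hW : Continuous W) : Continuous fun z => (W z).a₁ :=
  (continuous_coeffs_apply 0).comp hW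

@[fun_prop]
theorem continuous_a₂ (hW : Continuous W) : Continuous fun z => (W z).a₂ :=
  (continuous_coeffs_apply 1).comp hW

@[fun_prop]
theorem continuous_a₃ (hW : Continuous W) : Continuous fun z => (W z).a₃ :=
  (continuous_coeffs_apply 2).comp hW

@[fun_prop]
theorem continuous_a₄ (hW : Continuous W) : Continuous fun z => (W z).a₄ :=
  (continuous_coeffs_apply 3).comp hW

@[fun_prop]
theorem continuous_a₆ (hW : Continuous W) : Continuous fun z => (W z).a₆ :=
  (continuous_coeffs_apply 4).comp hW

theorem continuous_weierstrassCurve (h₁ : Continuous fun z => (W z).a₁)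
    (h₂ : Continuous fun z => (W z).a₂) (h₃ : Continuous fun z => (W z).a₃)
    (h₄ : Continuous fun z => (W z).a₄) (h₆ : Continuous fun z => (W z).a₆) : Continuous W := by
  refine continuous_induced_rng.mpr (continuous_pi fun i => ?_)
  fin_cases i
  exacts [h₁, h₂, h₃, h₄, h₆]

variable [CommRing R] [IsTopologicalRing R]

@[fun_prop]
theorem continuous_b₂ (hW : Continuous W) : Continuous fun z => (W z).b₂ := by
  unfold WeierstrassCurve.b₂
  fun_prop

@[fun_prop]
theorem continuous_b₆ (hW : Continuous W) : Continuous fun z => (W z).b₆ := by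
  unfold WeierstrassCurve.b₆
  fun_prop

@[fun_prop]
theorem continuous_b₈ (hW : Continuous W) : Continuous fun z => (W z).b₈ := by
  unfold WeierstrassCurve.b₈
  fun_prop

@[fun_prop]
theorem continuous_Δ (hW : Continuous W) : Continuous fun z => (W z).Δ := by
  unfold WeierstrassCurve.Δ WeierstrassCurve.b₄
  fun_prop

end Coefficients

/-! ### The recursion of Tate's algorithm -/

section Recursion

variable {R : Type*} [CommRing R]

theorem IsTranslate.refl (W : WeierstrassCurve R) : IsTranslate W W := ⟨1, rfl, (one_smul _ W).symm⟩

theorem IsTranslate.trans {W W' W'' : WeierstrassCurve R} (h : IsTranslate W W')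
    (h' : IsTranslate W' W'') : IsTranslate W W'' := by
  obtain ⟨T, hT, rfl⟩ := h
  obtain ⟨T', hT', rfl⟩ := h'
  exact ⟨T' * T, by simp [WeierstrassCurve.VariableChange.mul_def, hT, hT'], (mul_smul ..).symm⟩

theorem IsTranslate.symm {W W' : WeierstrassCurve R} (h : IsTranslate W W') : IsTranslate W' W := by
  obtain ⟨T, hT, rfl⟩ := h
  exact ⟨T⁻¹, by simp [WeierstrassCurve.VariableChange.inv_def, hT], (inv_smul_smul T W).symm⟩

theorem IsTranslate.Δ_eq {W W' : WeierstrassCurve R} (h : IsTranslate W W') : W'.Δ = W.Δ := by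
  obtain ⟨T, hT, rfl⟩ := h
  simp [WeierstrassCurve.variableChange_Δ, hT]

theorem IsRescaling.Δ_eq {π : R} {W W' : WeierstrassCurve R} (h : IsRescaling π W W') :
    W.Δ = π ^ 12 * W'.Δ := by
  obtain ⟨h₁, h₂, h₃, h₄, h₆⟩ := h
  simp only [WeierstrassCurve.Δ, WeierstrassCurve.b₂, WeierstrassCurve.b₄, WeierstrassCurve.b₆,
    WeierstrassCurve.b₈, h₁, h₂, h₃, h₄, h₆]
  ring

variable [IsLocalRing R] {π : R} {W W' : WeierstrassCurve R}

/-- Only the first step looks at the initial equation itself rather than at a translate of it. -/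
theorem Reaches.of_isTranslate (hW : IsTranslate W W') {s : Stage} {V : WeierstrassCurve R} {k : ℕ}
    (h : Reaches π W s V k) : s = .step1 ∧ k = 0 ∧ V = W ∨ Reaches π W' s V k := by
  induction h with
  | start => exact .inl ⟨rfl, rfl, rfl⟩
  | to2 _ hd ht hV ih =>
    refine .inr ?_
    obtain ⟨-, rfl, rfl⟩ | ih := ih
    · exact .to2 .start (hW.Δ_eq ▸ hd) (hW.symm.trans ht) hV
    · exact .to2 ih hd ht hV
  | to3 _ hd ih => exact .inr (.to3 (ih.resolve_left (by simp)) hd)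
  | to4 _ hd ih => exact .inr (.to4 (ih.resolve_left (by simp)) hd)
  | to5 _ hd ih => exact .inr (.to5 (ih.resolve_left (by simp)) hd)
  | to6 _ hd ht hV ih => exact .inr (.to6 (ih.resolve_left (by simp)) hd ht hV)
  | to7 _ hd ht hV ih => exact .inr (.to7 (ih.resolve_left (by simp)) hd ht hV)
  | to7X _ hd ht hV ih => exact .inr (.to7X (ih.resolve_left (by simp)) hd ht hV)
  | to7Y _ hd ht hV ih => exact .inr (.to7Y (ih.resolve_left (by simp)) hd ht hV)
  | to8 _ hd ht hV ih => exact .inr (.to8 (ih.resolve_left (by simp)) hd ht hV)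
  | to9 _ hd ht hV ih => exact .inr (.to9 (ih.resolve_left (by simp)) hd ht hV)
  | to10 _ hd ih => exact .inr (.to10 (ih.resolve_left (by simp)) hd)
  | to11 _ hd ih => exact .inr (.to11 (ih.resolve_left (by simp)) hd)
  | again _ hV ih => exact .inr (.again (ih.resolve_left (by simp)) hV)

theorem TateOutput.of_isTranslate (hW : IsTranslate W W') {r : KodairaType} {k : ℕ}
    (h : TateOutput π W r k) : TateOutput π W' r k := by
  cases h with
  | I_zero h hd =>
    obtain ⟨-, rfl, rfl⟩ | h := h.of_isTranslate hW
    · exact .I_zero .start (hW.Δ_eq ▸ hd)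
    · exact .I_zero h hd
  | I_pos h hd hn hn' => exact .I_pos ((h.of_isTranslate hW).resolve_left (by simp)) hd hn hn'
  | II h hd => exact .II ((h.of_isTranslate hW).resolve_left (by simp)) hd
  | III h hd => exact .III ((h.of_isTranslate hW).resolve_left (by simp)) hd
  | IV h hd => exact .IV ((h.of_isTranslate hW).resolve_left (by simp)) hd
  | Istar_zero h hd => exact .Istar_zero ((h.of_isTranslate hW).resolve_left (by simp)) hd
  | Istar_odd h hd => exact .Istar_odd ((h.of_isTranslate hW).resolve_left (by simp)) hd
  | Istar_even h hd => exact .Istar_even ((h.of_isTranslate hW).resolve_left (by simp)) hd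
  | IVstar h hd => exact .IVstar ((h.of_isTranslate hW).resolve_left (by simp)) hd
  | IIIstar h hd => exact .IIIstar ((h.of_isTranslate hW).resolve_left (by simp)) hd
  | IIstar h hd => exact .IIstar ((h.of_isTranslate hW).resolve_left (by simp)) hd

/-- A run that starts where another run restarts extends the latter. -/
theorem Reaches.of_reaches_step1 {m : ℕ} (hW : Reaches π W .step1 W' m) {s : Stage}
    {V : WeierstrassCurve R} {k : ℕ} (h : Reaches π W' s V k) : Reaches π W s V (k + m) := by
  induction h with
  | start => simpa using hW
  | to2 _ hd ht hV ih => exact .to2 ih hd ht hV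
  | to3 _ hd ih => exact .to3 ih hd
  | to4 _ hd ih => exact .to4 ih hd
  | to5 _ hd ih => exact .to5 ih hd
  | to6 _ hd ht hV ih => exact .to6 ih hd ht hV
  | to7 _ hd ht hV ih => exact .to7 ih hd ht hV
  | to7X _ hd ht hV ih => exact .to7X ih hd ht hV
  | to7Y _ hd ht hV ih => exact .to7Y ih hd ht hV
  | to8 _ hd ht hV ih => exact .to8 ih hd ht hV
  | to9 _ hd ht hV ih => exact .to9 ih hd ht hV
  | to10 _ hd ih => exact .to10 ih hd
  | to11 _ hd ih => exact .to11 ih hd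
  | again _ hV ih =>
    rw [Nat.add_right_comm]
    exact .again ih hV

theorem TateOutput.of_reaches_step1 {m : ℕ} (hW : Reaches π W .step1 W' m) {r : KodairaType}
    {k : ℕ} (h : TateOutput π W' r k) : TateOutput π W r (k + m) := by
  cases h with
  | I_zero h hd => exact .I_zero (.of_reaches_step1 hW h) hd
  | I_pos h hd hn hn' => exact .I_pos (.of_reaches_step1 hW h) hd hn hn'
  | II h hd => exact .II (.of_reaches_step1 hW h) hd
  | III h hd => exact .III (.of_reaches_step1 hW h) hd
  | IV h hd => exact .IV (.of_reaches_step1 hW h) hd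
  | Istar_zero h hd => exact .Istar_zero (.of_reaches_step1 hW h) hd
  | Istar_odd h hd => exact .Istar_odd (.of_reaches_step1 hW h) hd
  | Istar_even h hd => exact .Istar_even (.of_reaches_step1 hW h) hd
  | IVstar h hd => exact .IVstar (.of_reaches_step1 hW h) hd
  | IIIstar h hd => exact .IIIstar (.of_reaches_step1 hW h) hd
  | IIstar h hd => exact .IIstar (.of_reaches_step1 hW h) hd

/-- An equation with `π ^ i ∣ aᵢ` passes through all the steps: every polynomial that the algorithm
looks at has `0` as its only root. -/
theorem Reaches.of_isRescaling (hπ : ¬ IsUnit π) (h : IsRescaling π W W') :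
    Reaches π W .step1 W' 1 := by
  have hres : IsLocalRing.residue R π = 0 := by
    rwa [IsLocalRing.residue_eq_zero_iff, IsLocalRing.mem_maximalIdeal]
  have hΔ := h.Δ_eq
  have h' := h
  obtain ⟨h₁, h₂, h₃, h₄, h₆⟩ := h'
  have hdiv : ∀ {e i : ℕ} {a b : R}, a = π ^ i * b → e ≤ i → π ^ e ∣ a := fun h he =>
    h ▸ (pow_dvd_pow π he).mul_right _
  have h₁' : W.a₁ = π ^ 1 * W'.a₁ := by rw [h₁, pow_one]
  have hD : ∀ e₁ e₂ e₃ e₄ e₆ : ℕ, e₁ ≤ 1 → e₂ ≤ 2 → e₃ ≤ 3 → e₄ ≤ 4 → e₆ ≤ 6 →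
      DivBy π e₁ e₂ e₃ e₄ e₆ W := fun _ _ _ _ _ he₁ he₂ he₃ he₄ he₆ =>
    ⟨hdiv h₁' he₁, hdiv h₂ he₂, hdiv h₃ he₃, hdiv h₄ he₄, hdiv h₆ he₆⟩
  have hb₂ : W.b₂ = π * (π * (W'.a₁ ^ 2 + 4 * W'.a₂)) := by
    rw [WeierstrassCurve.b₂, h₁, h₂]; ring
  have hb₆ : W.b₆ = π ^ 3 * (π ^ 3 * W'.b₆) := by
    rw [WeierstrassCurve.b₆, WeierstrassCurve.b₆, h₃, h₆]; ring
  have hb₈ : W.b₈ = π ^ 3 * (π ^ 5 * W'.b₈) := by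
    rw [WeierstrassCurve.b₈, WeierstrassCurve.b₈, h₁, h₂, h₃, h₄, h₆]; ring
  have hIT := IsTranslate.refl W
  have r2 : Reaches π W .step2 W 0 := by
    refine .to2 .start ?_ hIT
      (hD _ _ _ _ _ (by simp) (by simp) (by simp) (by simp) (by simp))
    rw [hΔ]
    exact (dvd_pow_self π (by simp)).mul_right _
  have r5 : Reaches π W .step5 W 0 :=
    .to5 (.to4 (.to3 r2 ⟨_, hb₂⟩) (hdiv h₆ (by simp))) ⟨_, hb₈⟩
  have r6 : Reaches π W .step6 W 0 := .to6 r5 ⟨_, hb₆⟩ hIT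
    (hD _ _ _ _ _ (by simp) (by simp) (by simp) (by simp) (by simp))
  have r8 : Reaches π W .step8 W 0 := by
    refine .to8 r6 ⟨0, π * W'.a₂, π ^ 2 * W'.a₄, π ^ 3 * W'.a₆, ?_, ?_, ?_, ?_⟩ hIT
      (hD _ _ _ _ _ (by simp) (by simp) (by simp) (by simp) (by simp))
    · rw [h₂]; ring
    · rw [h₄]; ring
    · rw [h₆]; ring
    · simp [hres]
  have r9 : Reaches π W .step9 W 0 := by
    refine .to9 r8 ⟨Polynomial.X ^ 2, ⟨π * W'.a₃, π ^ 2 * W'.a₆, ?_, ?_, ?_⟩, fun hs => ?_⟩ hIT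
      (hD _ _ _ _ _ (by simp) (by simp) (by simp) (by simp) (by simp))
    · rw [h₃]; ring
    · rw [h₆]; ring
    · simp [hres]
    · rw [sq] at hs
      exact Polynomial.not_isUnit_X (hs.isCoprime.isUnit_of_dvd' dvd_rfl dvd_rfl)
  exact .again (.to11 (.to10 r9 (hdiv h₄ le_rfl)) (hdiv h₆ le_rfl)) h

/-- A run with at least one iteration is a run of the equation obtained in the first one. -/
theorem Reaches.decompose {s : Stage} {V : WeierstrassCurve R} {k : ℕ} (h : Reaches π W s V k) :
    k = 0 ∧ IsTranslate W V ∨ ∃ V₁ V₂ l, k = l + 1 ∧ IsTranslate W V₁ ∧ IsRescaling π V₁ V₂ ∧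
      Reaches π V₂ s V l := by
  induction h with
  | start => exact .inl ⟨rfl, .refl W⟩
  | to2 _ hd ht hV ih =>
    exact ih.imp (.imp_right fun h => h.trans ht)
      fun ⟨V₁, V₂, l, hk, h₁, h₂, h⟩ => ⟨V₁, V₂, l, hk, h₁, h₂, .to2 h hd ht hV⟩
  | to3 _ hd ih =>
    exact ih.imp_right fun ⟨V₁, V₂, l, hk, h₁, h₂, h⟩ => ⟨V₁, V₂, l, hk, h₁, h₂, .to3 h hd⟩
  | to4 _ hd ih =>
    exact ih.imp_right fun ⟨V₁, V₂, l, hk, h₁, h₂, h⟩ => ⟨V₁, V₂, l, hk, h₁, h₂, .to4 h hd⟩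
  | to5 _ hd ih =>
    exact ih.imp_right fun ⟨V₁, V₂, l, hk, h₁, h₂, h⟩ => ⟨V₁, V₂, l, hk, h₁, h₂, .to5 h hd⟩
  | to6 _ hd ht hV ih =>
    exact ih.imp (.imp_right fun h => h.trans ht)
      fun ⟨V₁, V₂, l, hk, h₁, h₂, h⟩ => ⟨V₁, V₂, l, hk, h₁, h₂, .to6 h hd ht hV⟩
  | to7 _ hd ht hV ih =>
    exact ih.imp (.imp_right fun h => h.trans ht)
      fun ⟨V₁, V₂, l, hk, h₁, h₂, h⟩ => ⟨V₁, V₂, l, hk, h₁, h₂, .to7 h hd ht hV⟩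
  | to7X _ hd ht hV ih =>
    exact ih.imp (.imp_right fun h => h.trans ht)
      fun ⟨V₁, V₂, l, hk, h₁, h₂, h⟩ => ⟨V₁, V₂, l, hk, h₁, h₂, .to7X h hd ht hV⟩
  | to7Y _ hd ht hV ih =>
    exact ih.imp (.imp_right fun h => h.trans ht)
      fun ⟨V₁, V₂, l, hk, h₁, h₂, h⟩ => ⟨V₁, V₂, l, hk, h₁, h₂, .to7Y h hd ht hV⟩
  | to8 _ hd ht hV ih =>
    exact ih.imp (.imp_right fun h => h.trans ht)
      fun ⟨V₁, V₂, l, hk, h₁, h₂, h⟩ => ⟨V₁, V₂, l, hk, h₁, h₂, .to8 h hd ht hV⟩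
  | to9 _ hd ht hV ih =>
    exact ih.imp (.imp_right fun h => h.trans ht)
      fun ⟨V₁, V₂, l, hk, h₁, h₂, h⟩ => ⟨V₁, V₂, l, hk, h₁, h₂, .to9 h hd ht hV⟩
  | to10 _ hd ih =>
    exact ih.imp_right fun ⟨V₁, V₂, l, hk, h₁, h₂, h⟩ => ⟨V₁, V₂, l, hk, h₁, h₂, .to10 h hd⟩
  | to11 _ hd ih =>
    exact ih.imp_right fun ⟨V₁, V₂, l, hk, h₁, h₂, h⟩ => ⟨V₁, V₂, l, hk, h₁, h₂, .to11 h hd⟩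
  | again _ hV ih =>
    obtain ⟨rfl, h⟩ | ⟨V₁, V₂, l, rfl, h₁, h₂, h⟩ := ih
    · exact .inr ⟨_, _, 0, rfl, h, hV, .start⟩
    · exact .inr ⟨V₁, V₂, l + 1, rfl, h₁, h₂, .again h hV⟩

theorem Reaches.decompose_succ {s : Stage} {V : WeierstrassCurve R} {k : ℕ}
    (h : Reaches π W s V (k + 1)) :
    ∃ V₁ V₂, IsTranslate W V₁ ∧ IsRescaling π V₁ V₂ ∧ Reaches π V₂ s V k := by
  obtain ⟨h, -⟩ | ⟨V₁, V₂, l, hl, h₁, h₂, h⟩ := h.decompose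
  · simp at h
  · obtain rfl : k = l := by simpa using hl
    exact ⟨V₁, V₂, h₁, h₂, h⟩

/-- The first iteration of Tate's algorithm replaces the equation with the rescaling of one of its
translates. -/
theorem tateOutput_succ_iff (hπ : ¬ IsUnit π) {r : KodairaType} {k : ℕ} :
    TateOutput π W r (k + 1) ↔
      ∃ V₁ V₂, IsTranslate W V₁ ∧ IsRescaling π V₁ V₂ ∧ TateOutput π V₂ r k := by
  constructor
  · intro h
    cases h with
    | I_zero h hd =>
      obtain ⟨V₁, V₂, h₁, h₂, h⟩ := h.decompose_succ
      exact ⟨V₁, V₂, h₁, h₂, .I_zero h hd⟩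
    | I_pos h hd hn hn' =>
      obtain ⟨V₁, V₂, h₁, h₂, h⟩ := h.decompose_succ
      exact ⟨V₁, V₂, h₁, h₂, .I_pos h hd hn hn'⟩
    | II h hd =>
      obtain ⟨V₁, V₂, h₁, h₂, h⟩ := h.decompose_succ
      exact ⟨V₁, V₂, h₁, h₂, .II h hd⟩
    | III h hd =>
      obtain ⟨V₁, V₂, h₁, h₂, h⟩ := h.decompose_succ
      exact ⟨V₁, V₂, h₁, h₂, .III h hd⟩
    | IV h hd =>
      obtain ⟨V₁, V₂, h₁, h₂, h⟩ := h.decompose_succ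
      exact ⟨V₁, V₂, h₁, h₂, .IV h hd⟩
    | Istar_zero h hd =>
      obtain ⟨V₁, V₂, h₁, h₂, h⟩ := h.decompose_succ
      exact ⟨V₁, V₂, h₁, h₂, .Istar_zero h hd⟩
    | Istar_odd h hd =>
      obtain ⟨V₁, V₂, h₁, h₂, h⟩ := h.decompose_succ
      exact ⟨V₁, V₂, h₁, h₂, .Istar_odd h hd⟩
    | Istar_even h hd =>
      obtain ⟨V₁, V₂, h₁, h₂, h⟩ := h.decompose_succ
      exact ⟨V₁, V₂, h₁, h₂, .Istar_even h hd⟩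
    | IVstar h hd =>
      obtain ⟨V₁, V₂, h₁, h₂, h⟩ := h.decompose_succ
      exact ⟨V₁, V₂, h₁, h₂, .IVstar h hd⟩
    | IIIstar h hd =>
      obtain ⟨V₁, V₂, h₁, h₂, h⟩ := h.decompose_succ
      exact ⟨V₁, V₂, h₁, h₂, .IIIstar h hd⟩
    | IIstar h hd =>
      obtain ⟨V₁, V₂, h₁, h₂, h⟩ := h.decompose_succ
      exact ⟨V₁, V₂, h₁, h₂, .IIstar h hd⟩
  · rintro ⟨V₁, V₂, h₁, h₂, h⟩
    exact (h.of_reaches_step1 (.of_isRescaling hπ h₂)).of_isTranslate h₁.symm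

end Recursion

/-! ### Tate's algorithm has sigma-compact level sets -/

section Stages

variable {L : Type*} [Field L] [hv : Valued L ℤᵐ⁰]

theorem dvd_iff_v_le {c x : 𝒪[L]} : c ∣ x ↔ hv.v (x : L) ≤ hv.v (c : L) :=
  ((Valuation.integer.integers hv.v).le_iff_dvd (x := x) (y := c)).symm

theorem isClopen_setOf_dvd {c : 𝒪[L]} (hc : c ≠ 0) : IsClopen {x : 𝒪[L] | c ∣ x} := by
  simp only [dvd_iff_v_le]
  exact (isClopen_setOf_v_le (c := (c : L)) (by simpa using hc)).preimage continuous_subtype_val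

/-- Conditions on residue classes are open and closed. -/
theorem isClopen_setOf_residue {Z : Type*} [TopologicalSpace Z] (p : 𝓀[L] → 𝓀[L] → 𝓀[L] → Prop)
    {f g h : Z → 𝒪[L]} (hf : Continuous f) (hg : Continuous g) (hh : Continuous h) :
    IsClopen {z | p (IsLocalRing.residue _ (f z)) (IsLocalRing.residue _ (g z))
      (IsLocalRing.residue _ (h z))} := by
  let : TopologicalSpace 𝓀[L] := ⊥
  have : DiscreteTopology 𝓀[L] := ⟨rfl⟩
  have hres : Continuous (IsLocalRing.residue 𝒪[L]) := by
    refine continuous_of_continuousAt_zero (IsLocalRing.residue 𝒪[L]) ?_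
    rw [ContinuousAt, map_zero, nhds_discrete 𝓀[L], Filter.tendsto_pure]
    have hopen : IsOpen {x : 𝒪[L] | hv.v (x : L) < hv.v 1} :=
      (isClopen_setOf_v_lt 1).isOpen.preimage continuous_subtype_val
    filter_upwards [hopen.mem_nhds (by simp)] with x hx
    rw [IsLocalRing.residue_eq_zero_iff, IsLocalRing.mem_maximalIdeal, mem_nonunits_iff,
      Valuation.Integers.isUnit_iff_valuation_eq_one (Valuation.integer.integers hv.v)]
    rw [map_one] at hx
    exact hx.ne
  have hc : Continuous fun z => (IsLocalRing.residue 𝒪[L] (f z), IsLocalRing.residue 𝒪[L] (g z),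
    IsLocalRing.residue 𝒪[L] (h z)) := by fun_prop
  exact (isClopen_discrete {x : 𝓀[L] × 𝓀[L] × 𝓀[L] | p x.1 x.2.1 x.2.2}).preimage hc

variable {Z : Type*} [TopologicalSpace Z] [SigmaCompactSpace Z]
  {V V' : Z → WeierstrassCurve 𝒪[L]}

theorem isSigmaCompact_setOf_dvd {c : 𝒪[L]} (hc : c ≠ 0) {f : Z → 𝒪[L]} (hf : Continuous f) :
    IsSigmaCompact {z | c ∣ f z} :=
  ((isClopen_setOf_dvd hc).preimage hf).isClosed.isSigmaCompact'

theorem isSigmaCompact_setOf_not_dvd {c : 𝒪[L]} (hc : c ≠ 0) {f : Z → 𝒪[L]} (hf : Continuous f) :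
    IsSigmaCompact {z | ¬ c ∣ f z} :=
  ((isClopen_setOf_dvd hc).compl.preimage hf).isClosed.isSigmaCompact'

theorem isSigmaCompact_setOf_divBy [T2Space Z] {π : 𝒪[L]} (hπ : π ≠ 0) (e₁ e₂ e₃ e₄ e₆ : ℕ)
    (hV : Continuous V) : IsSigmaCompact {z | DivBy π e₁ e₂ e₃ e₄ e₆ (V z)} := by
  unfold DivBy
  have h := fun n : ℕ => pow_ne_zero n hπ
  exact .setOf_and (isSigmaCompact_setOf_dvd (h _) (by fun_prop)) <|
    .setOf_and (isSigmaCompact_setOf_dvd (h _) (by fun_prop)) <|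
    .setOf_and (isSigmaCompact_setOf_dvd (h _) (by fun_prop)) <|
    .setOf_and (isSigmaCompact_setOf_dvd (h _) (by fun_prop)) <|
    isSigmaCompact_setOf_dvd (h _) (by fun_prop)

theorem isSigmaCompact_setOf_isRescaling (π : 𝒪[L]) (hV : Continuous V) (hV' : Continuous V') :
    IsSigmaCompact {z | IsRescaling π (V z) (V' z)} := by
  unfold IsRescaling
  refine IsClosed.isSigmaCompact' ?_
  exact (isClosed_eq (by fun_prop) (by fun_prop)).inter <|
    (isClosed_eq (by fun_prop) (by fun_prop)).inter <|
    (isClosed_eq (by fun_prop) (by fun_prop)).inter <|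
    (isClosed_eq (by fun_prop) (by fun_prop)).inter (isClosed_eq (by fun_prop) (by fun_prop))

/-- The pairs `(W, V)` for which the algorithm, started with `W`, gets to step `s` with `V` after
`k` iterations. -/
def stageSet (π : 𝒪[L]) (s : Stage) (k : ℕ) :
    Set (WeierstrassCurve 𝒪[L] × WeierstrassCurve 𝒪[L]) :=
  {x | Reaches π x.1 s x.2 k}

/-- A step that keeps the equation. -/
theorem isSigmaCompact_stageSet_of_keep {π : 𝒪[L]} {s s' : Stage} {k : ℕ}
    {q : WeierstrassCurve 𝒪[L] → Prop} (hs : IsSigmaCompact (stageSet π s k))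
    (hq : IsSigmaCompact {x : WeierstrassCurve 𝒪[L] × WeierstrassCurve 𝒪[L] | q x.2})
    (h : ∀ {W V}, Reaches π W s' V k ↔ Reaches π W s V k ∧ q V) :
    IsSigmaCompact (stageSet π s' k) := by
  simp only [stageSet, h]
  exact hs.setOf_and hq

variable [CompactSpace 𝒪[L]]

theorem isSigmaCompact_setOf_isTranslate (hV : Continuous V) (hV' : Continuous V') :
    IsSigmaCompact {z | IsTranslate (V z) (V' z)} := by
  have h : {z | IsTranslate (V z) (V' z)} =
      {z | ∃ t : 𝒪[L] × 𝒪[L] × 𝒪[L], V' z = (⟨1, t.1, t.2.1, t.2.2⟩ :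
        WeierstrassCurve.VariableChange 𝒪[L]) • V z} := by
    ext z
    constructor
    · rintro ⟨⟨u, r, s, t⟩, rfl, h⟩
      exact ⟨(r, s, t), h⟩
    · rintro ⟨t, h⟩
      exact ⟨_, rfl, h⟩
  rw [h]
  refine .setOf_exists (IsClosed.isSigmaCompact' (isClosed_eq (by fun_prop) ?_))
  apply continuous_weierstrassCurve <;>
    simp only [WeierstrassCurve.variableChange_def, inv_one, Units.val_one] <;> fun_prop

theorem isSigmaCompact_setOf_isCubic (π : 𝒪[L]) (p : Polynomial 𝓀[L] → Prop) (hV : Continuous V) :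
    IsSigmaCompact {z | ∃ P, IsCubic π (V z) P ∧ p P} := by
  have h : {z | ∃ P, IsCubic π (V z) P ∧ p P} = {z | ∃ c : 𝒪[L] × 𝒪[L] × 𝒪[L],
      (V z).a₂ = π * c.1 ∧ (V z).a₄ = π ^ 2 * c.2.1 ∧ (V z).a₆ = π ^ 3 * c.2.2 ∧
      p (Polynomial.X ^ 3 + Polynomial.C (IsLocalRing.residue _ c.1) * Polynomial.X ^ 2
        + Polynomial.C (IsLocalRing.residue _ c.2.1) * Polynomial.X
        + Polynomial.C (IsLocalRing.residue _ c.2.2))} := by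
    ext z
    constructor
    · rintro ⟨P, ⟨c₂, c₄, c₆, h₂, h₄, h₆, rfl⟩, hp⟩
      exact ⟨(c₂, c₄, c₆), h₂, h₄, h₆, hp⟩
    · rintro ⟨⟨c₂, c₄, c₆⟩, h₂, h₄, h₆, hp⟩
      exact ⟨_, ⟨c₂, c₄, c₆, h₂, h₄, h₆, rfl⟩, hp⟩
  rw [h]
  refine .setOf_exists (IsClosed.isSigmaCompact' ?_)
  exact (isClosed_eq (by fun_prop) (by fun_prop)).inter <|
    (isClosed_eq (by fun_prop) (by fun_prop)).inter <|
    (isClosed_eq (by fun_prop) (by fun_prop)).inter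
    (isClopen_setOf_residue (fun a b c => p (Polynomial.X ^ 3 + Polynomial.C a * Polynomial.X ^ 2
      + Polynomial.C b * Polynomial.X + Polynomial.C c)) (by fun_prop) (by fun_prop)
      (by fun_prop)).isClosed

theorem isSigmaCompact_setOf_isQuadY (π : 𝒪[L]) (i : ℕ) (p : Polynomial 𝓀[L] → Prop)
    (hV : Continuous V) : IsSigmaCompact {z | ∃ Q, IsQuadY π i (V z) Q ∧ p Q} := by
  have h : {z | ∃ Q, IsQuadY π i (V z) Q ∧ p Q} = {z | ∃ c : 𝒪[L] × 𝒪[L],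
      (V z).a₃ = π ^ i * c.1 ∧ (V z).a₆ = π ^ (2 * i) * c.2 ∧
      p (Polynomial.X ^ 2 + Polynomial.C (IsLocalRing.residue _ c.1) * Polynomial.X
        - Polynomial.C (IsLocalRing.residue _ c.2))} := by
    ext z
    constructor
    · rintro ⟨P, ⟨c₃, c₆, h₃, h₆, rfl⟩, hp⟩
      exact ⟨(c₃, c₆), h₃, h₆, hp⟩
    · rintro ⟨⟨c₃, c₆⟩, h₃, h₆, hp⟩
      exact ⟨_, ⟨c₃, c₆, h₃, h₆, rfl⟩, hp⟩
  rw [h]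
  refine .setOf_exists (IsClosed.isSigmaCompact' ?_)
  exact (isClosed_eq (by fun_prop) (by fun_prop)).inter <|
    (isClosed_eq (by fun_prop) (by fun_prop)).inter
    (isClopen_setOf_residue (fun a b _ => p (Polynomial.X ^ 2 + Polynomial.C a * Polynomial.X
      - Polynomial.C b)) (h := fun _ => 0) (by fun_prop) (by fun_prop) (by fun_prop)).isClosed

theorem isSigmaCompact_setOf_isQuadX (π : 𝒪[L]) (j : ℕ) (p : Polynomial 𝓀[L] → Prop)
    (hV : Continuous V) : IsSigmaCompact {z | ∃ Q, IsQuadX π j (V z) Q ∧ p Q} := by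
  have h : {z | ∃ Q, IsQuadX π j (V z) Q ∧ p Q} = {z | ∃ c : 𝒪[L] × 𝒪[L] × 𝒪[L],
      (V z).a₂ = π * c.1 ∧ (V z).a₄ = π ^ (j + 3) * c.2.1 ∧ (V z).a₆ = π ^ (2 * j + 5) * c.2.2 ∧
      p (Polynomial.C (IsLocalRing.residue _ c.1) * Polynomial.X ^ 2
        + Polynomial.C (IsLocalRing.residue _ c.2.1) * Polynomial.X
        + Polynomial.C (IsLocalRing.residue _ c.2.2))} := by
    ext z
    constructor
    · rintro ⟨P, ⟨c₂, c₄, c₆, h₂, h₄, h₆, rfl⟩, hp⟩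
      exact ⟨(c₂, c₄, c₆), h₂, h₄, h₆, hp⟩
    · rintro ⟨⟨c₂, c₄, c₆⟩, h₂, h₄, h₆, hp⟩
      exact ⟨_, ⟨c₂, c₄, c₆, h₂, h₄, h₆, rfl⟩, hp⟩
  rw [h]
  refine .setOf_exists (IsClosed.isSigmaCompact' ?_)
  exact (isClosed_eq (by fun_prop) (by fun_prop)).inter <|
    (isClosed_eq (by fun_prop) (by fun_prop)).inter <|
    (isClosed_eq (by fun_prop) (by fun_prop)).inter
    (isClopen_setOf_residue (fun a b c => p (Polynomial.C a * Polynomial.X ^ 2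
      + Polynomial.C b * Polynomial.X + Polynomial.C c)) (by fun_prop) (by fun_prop)
      (by fun_prop)).isClosed

variable {π : 𝒪[L]}

/-- A step that changes the equation. -/
theorem isSigmaCompact_stageSet_of_change {s s' : Stage} {k k' : ℕ}
    {q : WeierstrassCurve 𝒪[L] → WeierstrassCurve 𝒪[L] → Prop}
    (hs : IsSigmaCompact (stageSet π s k))
    (hq : IsSigmaCompact {x : WeierstrassCurve 𝒪[L] × WeierstrassCurve 𝒪[L] | q x.1 x.2})
    (h : ∀ {W V'}, Reaches π W s' V' k' ↔ ∃ V, Reaches π W s V k ∧ q V V') :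
    IsSigmaCompact (stageSet π s' k') := by
  simp only [stageSet, h]
  exact .relComp (p := fun W V => Reaches π W s V k) hs hq

theorem isSigmaCompact_stageSet_of_translate {s s' : Stage} {k : ℕ}
    {q : WeierstrassCurve 𝒪[L] → Prop} (hπ : π ≠ 0) (e₁ e₂ e₃ e₄ e₆ : ℕ)
    (hs : IsSigmaCompact (stageSet π s k))
    (hq : IsSigmaCompact {x : WeierstrassCurve 𝒪[L] × WeierstrassCurve 𝒪[L] | q x.1})
    (h : ∀ {W V'}, Reaches π W s' V' k ↔
      ∃ V, Reaches π W s V k ∧ q V ∧ IsTranslate V V' ∧ DivBy π e₁ e₂ e₃ e₄ e₆ V') :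
    IsSigmaCompact (stageSet π s' k) :=
  isSigmaCompact_stageSet_of_change hs (hq.setOf_and <|
    (isSigmaCompact_setOf_isTranslate (by fun_prop) (by fun_prop)).setOf_and
      (isSigmaCompact_setOf_divBy hπ e₁ e₂ e₃ e₄ e₆ (by fun_prop))) h

theorem isSigmaCompact_stageSet_step7Y_zero (hπ : π ≠ 0) {k : ℕ}
    (h₆ : IsSigmaCompact (stageSet π .step6 k)) :
    IsSigmaCompact (stageSet π (.step7Y 0) k) := by
  obtain ⟨p, hp⟩ : ∃ p : Polynomial 𝓀[L] → Prop, ∀ P, p P ↔ ∃ ρ σ : 𝓀[L], ρ ≠ σ ∧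
      P = (Polynomial.X - Polynomial.C ρ) ^ 2 * (Polynomial.X - Polynomial.C σ) :=
    ⟨_, fun _ => Iff.rfl⟩
  refine isSigmaCompact_stageSet_of_translate hπ 1 1 2 3 4 h₆
    (q := fun V => ∃ P, IsCubic π V P ∧ p P)
    (isSigmaCompact_setOf_isCubic π p continuous_fst) ⟨fun h => ?_, ?_⟩
  · cases h with | to7 h hd ht hV => ?_
    obtain ⟨ρ, σ, hd, hd'⟩ := hd
    exact ⟨_, h, ⟨_, hd', (hp _).mpr ⟨ρ, σ, hd, rfl⟩⟩, ht, hV⟩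
  · rintro ⟨_, h, ⟨P, hd', hP⟩, ht, hV⟩
    obtain ⟨ρ, σ, hd, rfl⟩ := (hp P).mp hP
    exact .to7 h ⟨ρ, σ, hd, hd'⟩ ht hV

theorem isSigmaCompact_stageSet_step8 (hπ : π ≠ 0) {k : ℕ}
    (h₆ : IsSigmaCompact (stageSet π .step6 k)) : IsSigmaCompact (stageSet π .step8 k) := by
  obtain ⟨p, hp⟩ : ∃ p : Polynomial 𝓀[L] → Prop, ∀ P, p P ↔ ∃ ρ : 𝓀[L],
      P = (Polynomial.X - Polynomial.C ρ) ^ 3 := ⟨_, fun _ => Iff.rfl⟩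
  refine isSigmaCompact_stageSet_of_translate hπ 1 2 2 3 4 h₆
    (q := fun V => ∃ P, IsCubic π V P ∧ p P)
    (isSigmaCompact_setOf_isCubic π p continuous_fst) ⟨fun h => ?_, ?_⟩
  · cases h with | to8 h hd ht hV => ?_
    obtain ⟨ρ, hd⟩ := hd
    exact ⟨_, h, ⟨_, hd, (hp _).mpr ⟨ρ, rfl⟩⟩, ht, hV⟩
  · rintro ⟨_, h, ⟨P, hd, hP⟩, ht, hV⟩
    obtain ⟨ρ, rfl⟩ := (hp P).mp hP
    exact .to8 h ⟨ρ, hd⟩ ht hV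

theorem isSigmaCompact_stageSet_of_step1 (hπ : π ≠ 0) {k : ℕ}
    (h₁ : IsSigmaCompact (stageSet π .step1 k)) (s : Stage) :
    IsSigmaCompact (stageSet π s k) := by
  have hp := fun n : ℕ => pow_ne_zero n hπ
  have h₂ : IsSigmaCompact (stageSet π .step2 k) :=
    isSigmaCompact_stageSet_of_translate hπ 0 0 1 1 1 h₁
      (q := fun V => π ∣ V.Δ) (isSigmaCompact_setOf_dvd hπ (by fun_prop))
      ⟨fun | .to2 h hd ht hV => ⟨_, h, hd, ht, hV⟩, fun ⟨_, h, hd, ht, hV⟩ => .to2 h hd ht hV⟩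
  have h₃ : IsSigmaCompact (stageSet π .step3 k) :=
    isSigmaCompact_stageSet_of_keep h₂ (q := fun V => π ∣ V.b₂)
      (isSigmaCompact_setOf_dvd hπ (by fun_prop))
      ⟨fun | .to3 h hd => ⟨h, hd⟩, fun ⟨h, hd⟩ => .to3 h hd⟩
  have h₄ : IsSigmaCompact (stageSet π .step4 k) :=
    isSigmaCompact_stageSet_of_keep h₃ (q := fun V => π ^ 2 ∣ V.a₆)
      (isSigmaCompact_setOf_dvd (hp _) (by fun_prop))
      ⟨fun | .to4 h hd => ⟨h, hd⟩, fun ⟨h, hd⟩ => .to4 h hd⟩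
  have h₅ : IsSigmaCompact (stageSet π .step5 k) :=
    isSigmaCompact_stageSet_of_keep h₄ (q := fun V => π ^ 3 ∣ V.b₈)
      (isSigmaCompact_setOf_dvd (hp _) (by fun_prop))
      ⟨fun | .to5 h hd => ⟨h, hd⟩, fun ⟨h, hd⟩ => .to5 h hd⟩
  have h₆ : IsSigmaCompact (stageSet π .step6 k) :=
    isSigmaCompact_stageSet_of_translate hπ 1 1 2 2 3 h₅
      (q := fun V => π ^ 3 ∣ V.b₆) (isSigmaCompact_setOf_dvd (hp _) (by fun_prop))
      ⟨fun | .to6 h hd ht hV => ⟨_, h, hd, ht, hV⟩, fun ⟨_, h, hd, ht, hV⟩ => .to6 h hd ht hV⟩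
  have h₇ : ∀ j, IsSigmaCompact (stageSet π (.step7Y j) k) ∧
      IsSigmaCompact (stageSet π (.step7X j) k) := by
    have hX : ∀ {j}, IsSigmaCompact (stageSet π (.step7Y j) k) →
        IsSigmaCompact (stageSet π (.step7X j) k) := fun {j} h =>
      isSigmaCompact_stageSet_of_translate hπ 1 1 (j + 3) (j + 3) (2 * j + 5) h
        (isSigmaCompact_setOf_isQuadY π (j + 2) (fun Q => ¬ Q.Separable) (by fun_prop))
        ⟨fun | .to7X h hd ht hV => ⟨_, h, hd, ht, hV⟩, fun ⟨_, h, hd, ht, hV⟩ => .to7X h hd ht hV⟩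
    intro j
    induction j with
    | zero =>
      have h0 := isSigmaCompact_stageSet_step7Y_zero hπ h₆
      exact ⟨h0, hX h0⟩
    | succ j ih =>
      have h1 : IsSigmaCompact (stageSet π (.step7Y (j + 1)) k) :=
        isSigmaCompact_stageSet_of_translate hπ 1 1 (j + 3) (j + 4) (2 * j + 6) ih.2
          (isSigmaCompact_setOf_isQuadX π j (fun Q => ¬ Q.Separable) (by fun_prop))
          ⟨fun | .to7Y h hd ht hV => ⟨_, h, hd, ht, hV⟩,
            fun ⟨_, h, hd, ht, hV⟩ => .to7Y h hd ht hV⟩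
      exact ⟨h1, hX h1⟩
  have h₈ := isSigmaCompact_stageSet_step8 hπ h₆
  have h₉ : IsSigmaCompact (stageSet π .step9 k) :=
    isSigmaCompact_stageSet_of_translate hπ 1 2 3 3 5 h₈
      (isSigmaCompact_setOf_isQuadY π 2 (fun Q => ¬ Q.Separable) (by fun_prop))
      ⟨fun | .to9 h hd ht hV => ⟨_, h, hd, ht, hV⟩, fun ⟨_, h, hd, ht, hV⟩ => .to9 h hd ht hV⟩
  have h₁₀ : IsSigmaCompact (stageSet π .step10 k) :=
    isSigmaCompact_stageSet_of_keep h₉ (q := fun V => π ^ 4 ∣ V.a₄)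
      (isSigmaCompact_setOf_dvd (hp _) (by fun_prop))
      ⟨fun | .to10 h hd => ⟨h, hd⟩, fun ⟨h, hd⟩ => .to10 h hd⟩
  have h₁₁ : IsSigmaCompact (stageSet π .step11 k) :=
    isSigmaCompact_stageSet_of_keep h₁₀ (q := fun V => π ^ 6 ∣ V.a₆)
      (isSigmaCompact_setOf_dvd (hp _) (by fun_prop))
      ⟨fun | .to11 h hd => ⟨h, hd⟩, fun ⟨h, hd⟩ => .to11 h hd⟩
  match s with
  | .step1 => exact h₁
  | .step2 => exact h₂
  | .step3 => exact h₃
  | .step4 => exact h₄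
  | .step5 => exact h₅
  | .step6 => exact h₆
  | .step7Y j => exact (h₇ j).1
  | .step7X j => exact (h₇ j).2
  | .step8 => exact h₈
  | .step9 => exact h₉
  | .step10 => exact h₁₀
  | .step11 => exact h₁₁

theorem isSigmaCompact_stageSet (hπ : π ≠ 0) (s : Stage) (k : ℕ) :
    IsSigmaCompact (stageSet π s k) := by
  induction k generalizing s with
  | zero =>
    refine isSigmaCompact_stageSet_of_step1 hπ ?_ s
    have h : stageSet π .step1 0 = {x | x.2 = x.1} := by
      ext ⟨W, V⟩
      constructor
      · rintro (_ | _)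
        rfl
      · intro h
        obtain rfl : V = W := h
        exact .start
    rw [h]
    exact (isClosed_eq (by fun_prop) (by fun_prop)).isSigmaCompact'
  | succ k ih =>
    refine isSigmaCompact_stageSet_of_step1 hπ ?_ s
    exact isSigmaCompact_stageSet_of_change (ih .step11)
      (isSigmaCompact_setOf_isRescaling π (by fun_prop) (by fun_prop))
      ⟨fun | .again h hV => ⟨_, h, hV⟩, fun ⟨_, h, hV⟩ => .again h hV⟩

/-- A stopping condition `q` at step `s` that alone leads to the type `r`. -/
theorem isSigmaCompact_setOf_stop (hπ : π ≠ 0) {r : KodairaType} {k : ℕ} (s : Stage)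
    {q : WeierstrassCurve 𝒪[L] → Prop}
    (hq : IsSigmaCompact {x : WeierstrassCurve 𝒪[L] × WeierstrassCurve 𝒪[L] | q x.2})
    (h : ∀ {W}, TateOutput π W r k ↔ ∃ V, Reaches π W s V k ∧ q V) :
    IsSigmaCompact {W : WeierstrassCurve 𝒪[L] | TateOutput π W r k} := by
  simp only [h]
  exact .setOf_exists ((isSigmaCompact_stageSet hπ s k).setOf_and hq)

theorem isSigmaCompact_setOf_tateOutput (hπ : π ≠ 0) (r : KodairaType) (k : ℕ) :
    IsSigmaCompact {W : WeierstrassCurve 𝒪[L] | TateOutput π W r k} := by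
  have hp := fun n : ℕ => pow_ne_zero n hπ
  match r with
  | .I 0 =>
    -- The type `I_0` arises in step 1 and, by the rule for `I_n` with `n = 0`, formally in step 2.
    have h1 : IsSigmaCompact {W : WeierstrassCurve 𝒪[L] | ∃ V, Reaches π W .step1 V k ∧ ¬ π ∣ V.Δ} :=
      .setOf_exists ((isSigmaCompact_stageSet hπ .step1 k).setOf_and
        (isSigmaCompact_setOf_not_dvd hπ (by fun_prop)))
    have h2 : IsSigmaCompact {W : WeierstrassCurve 𝒪[L] | ∃ V, Reaches π W .step2 V k ∧
        ¬ π ∣ V.b₂ ∧ ¬ π ∣ V.Δ} :=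
      .setOf_exists ((isSigmaCompact_stageSet hπ .step2 k).setOf_and
        ((isSigmaCompact_setOf_not_dvd hπ (by fun_prop)).setOf_and
          (isSigmaCompact_setOf_not_dvd hπ (by fun_prop))))
    convert h1.setOf_or h2 using 3 with W
    constructor
    · intro h
      cases h with
      | I_zero h hd => exact .inl ⟨_, h, hd⟩
      | I_pos h hd hn hn' => exact .inr ⟨_, h, hd, by simpa using hn'⟩
    · rintro (⟨V, h, hd⟩ | ⟨V, h, hd, hn⟩)
      · exact .I_zero h hd
      · exact .I_pos h hd (by simp) (by simpa using hn)
  | .I (n + 1) =>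
    exact isSigmaCompact_setOf_stop hπ .step2
      (q := fun V => ¬ π ∣ V.b₂ ∧ π ^ (n + 1) ∣ V.Δ ∧ ¬ π ^ (n + 1 + 1) ∣ V.Δ)
      ((isSigmaCompact_setOf_not_dvd hπ (by fun_prop)).setOf_and
        ((isSigmaCompact_setOf_dvd (hp _) (by fun_prop)).setOf_and
          (isSigmaCompact_setOf_not_dvd (hp _) (by fun_prop))))
      ⟨fun | .I_pos h hd hn hn' => ⟨_, h, hd, hn, hn'⟩,
        fun ⟨_, h, hd, hn, hn'⟩ => .I_pos h hd hn hn'⟩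
  | .II =>
    exact isSigmaCompact_setOf_stop hπ .step3 (q := fun V => ¬ π ^ 2 ∣ V.a₆)
      (isSigmaCompact_setOf_not_dvd (hp _) (by fun_prop))
      ⟨fun | .II h hd => ⟨_, h, hd⟩, fun ⟨_, h, hd⟩ => .II h hd⟩
  | .III =>
    exact isSigmaCompact_setOf_stop hπ .step4 (q := fun V => ¬ π ^ 3 ∣ V.b₈)
      (isSigmaCompact_setOf_not_dvd (hp _) (by fun_prop))
      ⟨fun | .III h hd => ⟨_, h, hd⟩, fun ⟨_, h, hd⟩ => .III h hd⟩
  | .IV =>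
    exact isSigmaCompact_setOf_stop hπ .step5 (q := fun V => ¬ π ^ 3 ∣ V.b₆)
      (isSigmaCompact_setOf_not_dvd (hp _) (by fun_prop))
      ⟨fun | .IV h hd => ⟨_, h, hd⟩, fun ⟨_, h, hd⟩ => .IV h hd⟩
  | .Istar 0 =>
    exact isSigmaCompact_setOf_stop hπ .step6
      (isSigmaCompact_setOf_isCubic π Polynomial.Separable (by fun_prop))
      ⟨fun | .Istar_zero h hd => ⟨_, h, hd⟩, fun ⟨_, h, hd⟩ => .Istar_zero h hd⟩
  | .Istar (n + 1) =>
    obtain ⟨j, rfl | rfl⟩ := n.even_or_odd'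
    · refine isSigmaCompact_setOf_stop hπ (.step7Y j)
        (isSigmaCompact_setOf_isQuadY π (j + 2) Polynomial.Separable (by fun_prop))
        ⟨fun h => ?_, fun ⟨_, h, hd⟩ => .Istar_odd h hd⟩
      generalize hr : KodairaType.Istar (2 * j + 1) = r at h
      cases h with
      | Istar_zero => simp at hr
      | @Istar_odd _ _ i h hd =>
        obtain rfl : j = i := by simpa using hr
        exact ⟨_, h, hd⟩
      | Istar_even =>
        rw [KodairaType.Istar.injEq] at hr
        omega
      | _ => simp at hr
    · refine isSigmaCompact_setOf_stop hπ (.step7X j)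
        (isSigmaCompact_setOf_isQuadX π j Polynomial.Separable (by fun_prop))
        ⟨fun h => ?_, fun ⟨_, h, hd⟩ => .Istar_even h hd⟩
      generalize hr : KodairaType.Istar (2 * j + 1 + 1) = r at h
      cases h with
      | Istar_zero => simp at hr
      | Istar_odd =>
        rw [KodairaType.Istar.injEq] at hr
        omega
      | @Istar_even _ _ i h hd =>
        obtain rfl : j = i := by simpa using hr
        exact ⟨_, h, hd⟩
      | _ => simp at hr
  | .IVstar =>
    exact isSigmaCompact_setOf_stop hπ .step8
      (isSigmaCompact_setOf_isQuadY π 2 Polynomial.Separable (by fun_prop))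
      ⟨fun | .IVstar h hd => ⟨_, h, hd⟩, fun ⟨_, h, hd⟩ => .IVstar h hd⟩
  | .IIIstar =>
    exact isSigmaCompact_setOf_stop hπ .step9 (q := fun V => ¬ π ^ 4 ∣ V.a₄)
      (isSigmaCompact_setOf_not_dvd (hp _) (by fun_prop))
      ⟨fun | .IIIstar h hd => ⟨_, h, hd⟩, fun ⟨_, h, hd⟩ => .IIIstar h hd⟩
  | .IIstar =>
    exact isSigmaCompact_setOf_stop hπ .step10 (q := fun V => ¬ π ^ 6 ∣ V.a₆)
      (isSigmaCompact_setOf_not_dvd (hp _) (by fun_prop))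
      ⟨fun | .IIstar h hd => ⟨_, h, hd⟩, fun ⟨_, h, hd⟩ => .IIstar h hd⟩

end Stages

/-! ### Points under a change of variables -/

section VariableChange

variable {F : Type*} [Field F]

/-- The coefficients of `W` in terms of those of `T • W`. -/
theorem eq_of_variableChange (T : WeierstrassCurve.VariableChange F) (W : WeierstrassCurve F) :
    W.a₁ = T.u * (T • W).a₁ - 2 * T.s ∧
    W.a₂ = T.u ^ 2 * (T • W).a₂ + T.s * W.a₁ - 3 * T.r + T.s ^ 2 ∧
    W.a₃ = T.u ^ 3 * (T • W).a₃ - T.r * W.a₁ - 2 * T.t ∧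
    W.a₄ = T.u ^ 4 * (T • W).a₄ + T.s * W.a₃ - 2 * T.r * W.a₂ + (T.t + T.r * T.s) * W.a₁
      - 3 * T.r ^ 2 + 2 * T.s * T.t ∧
    W.a₆ = T.u ^ 6 * (T • W).a₆ - T.r * W.a₄ - T.r ^ 2 * W.a₂ - T.r ^ 3 + T.t * W.a₃ + T.t ^ 2
      + T.r * T.t * W.a₁ := by
  have hu : (T.u : F) ≠ 0 := T.u.ne_zero
  simp only [WeierstrassCurve.variableChange_def, Units.val_inv_eq_inv_val]
  refine ⟨?_, ?_, ?_, ?_, ?_⟩ <;> field_simp <;> ring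

variable {W : WeierstrassCurve F} (T : WeierstrassCurve.VariableChange F)

/-- The abscissa on `W` of a point of `T • W`. -/
def changeX (x : F) : F := T.u ^ 2 * x + T.r

/-- The ordinate on `W` of a point of `T • W`. -/
def changeY (x y : F) : F := T.u ^ 3 * y + T.u ^ 2 * T.s * x + T.t

theorem partialY_change (x y : F) :
    2 * changeY T x y + W.a₁ * changeX T x + W.a₃ =
      T.u ^ 3 * (2 * y + (T • W).a₁ * x + (T • W).a₃) := by
  obtain ⟨h₁, -, h₃, -⟩ := eq_of_variableChange T W
  rw [h₃, h₁, changeX, changeY]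
  ring

theorem partialX_change (x y : F) :
    W.a₁ * changeY T x y - (3 * changeX T x ^ 2 + 2 * W.a₂ * changeX T x + W.a₄) =
      T.u ^ 4 * ((T • W).a₁ * y - (3 * x ^ 2 + 2 * (T • W).a₂ * x + (T • W).a₄))
        - T.s * (T.u ^ 3 * (2 * y + (T • W).a₁ * x + (T • W).a₃)) := by
  obtain ⟨h₁, h₂, h₃, h₄, -⟩ := eq_of_variableChange T W
  rw [h₄, h₃, h₂, h₁, changeX, changeY]
  ring

theorem nonsingular_change {x y : F} (h : (T • W).toAffine.Nonsingular x y) :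
    W.toAffine.Nonsingular (changeX T x) (changeY T x y) := by
  have hu : (T.u : F) ≠ 0 := T.u.ne_zero
  rw [WeierstrassCurve.Affine.nonsingular_iff', WeierstrassCurve.Affine.equation_iff'] at h ⊢
  refine ⟨?_, ?_⟩
  · rw [← mul_zero ((T.u : F) ^ 6), ← h.1]
    obtain ⟨h₁, h₂, h₃, h₄, h₆⟩ := eq_of_variableChange T W
    rw [h₆, h₄, h₃, h₂, h₁, changeX, changeY]
    ring
  · rw [partialX_change T, partialY_change T]
    by_contra! h0
    have hY : 2 * y + (T • W).a₁ * x + (T • W).a₃ = 0 := by simpa [hu] using h0.2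
    have hX := h0.1
    rw [hY] at hX
    have hX' : (T • W).a₁ * y - (3 * x ^ 2 + 2 * (T • W).a₂ * x + (T • W).a₄) = 0 := by
      simpa [hu] using hX
    exact h.2.elim (· hX') (· hY)

/-- The map from the points of `T • W` to the points of `W`. -/
def changePoint : (T • W).toAffine.Point → W.toAffine.Point
  | .zero => .zero
  | .some _ _ h => .some _ _ (nonsingular_change T h)

theorem negY_change (x y : F) :
    W.toAffine.negY (changeX T x) (changeY T x y) =
      changeY T x ((T • W).toAffine.negY x y) := by
  have h := partialY_change T (W := W) x y
  simp only [WeierstrassCurve.Affine.negY]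
  simp only [changeY] at h ⊢
  linear_combination -h

theorem changeX_inj {x₁ x₂ : F} : changeX T x₁ = changeX T x₂ ↔ x₁ = x₂ := by
  simp [changeX]

theorem changeY_inj {x y₁ y₂ : F} : changeY T x y₁ = changeY T x y₂ ↔ y₁ = y₂ := by
  simp [changeY]

variable [DecidableEq F]

theorem slope_change {x₁ x₂ y₁ y₂ : F} (h₁ : (T • W).toAffine.Equation x₁ y₁)
    (h₂ : (T • W).toAffine.Equation x₂ y₂) (hxy : ¬(x₁ = x₂ ∧ y₁ = (T • W).toAffine.negY x₂ y₂)) :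
    W.toAffine.slope (changeX T x₁) (changeX T x₂) (changeY T x₁ y₁) (changeY T x₂ y₂) =
      T.u * (T • W).toAffine.slope x₁ x₂ y₁ y₂ + T.s := by
  have hu : (T.u : F) ≠ 0 := T.u.ne_zero
  by_cases hx : x₁ = x₂
  · subst hx
    have hy : y₁ ≠ (T • W).toAffine.negY x₁ y₂ := fun h => hxy ⟨rfl, h⟩
    have hy' : changeY T x₁ y₁ ≠ W.toAffine.negY (changeX T x₁) (changeY T x₁ y₂) := by
      rwa [negY_change, Ne, changeY_inj]
    obtain rfl := WeierstrassCurve.Affine.Y_eq_of_Y_ne h₁ h₂ rfl hy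
    rw [WeierstrassCurve.Affine.slope_of_Y_ne rfl hy', div_eq_iff (sub_ne_zero.mpr hy')]
    have hq := (div_eq_iff (sub_ne_zero.mpr hy)).mp
      (WeierstrassCurve.Affine.slope_of_Y_ne (W := (T • W).toAffine) (x₁ := x₁) rfl hy).symm
    have hX := partialX_change T (W := W) x₁ y₁
    have hY := partialY_change T (W := W) x₁ y₁
    simp only [WeierstrassCurve.Affine.negY] at hq ⊢
    generalize (T • W).toAffine.slope x₁ x₁ y₁ y₁ = q at hq ⊢
    linear_combination -hX - (T.u * q + T.s) * hY + T.u ^ 4 * hq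
  · rw [WeierstrassCurve.Affine.slope_of_X_ne hx,
      WeierstrassCurve.Affine.slope_of_X_ne (by rwa [Ne, changeX_inj])]
    have h1 : x₁ - x₂ ≠ 0 := sub_ne_zero.mpr hx
    have h2 : changeX T x₁ - changeX T x₂ = T.u ^ 2 * (x₁ - x₂) := by simp only [changeX]; ring
    rw [h2]
    simp only [changeY]
    field_simp
    ring

theorem changePoint_add (P Q : (T • W).toAffine.Point) :
    changePoint T (P + Q) = changePoint T P + changePoint T Q := by
  match P, Q with
  | .zero, Q =>
    rw [← WeierstrassCurve.Affine.Point.zero_def, zero_add]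
    exact (zero_add (changePoint T Q)).symm
  | .some x₁ y₁ h₁, .zero =>
    rw [← WeierstrassCurve.Affine.Point.zero_def, add_zero]
    exact (add_zero (changePoint T (.some x₁ y₁ h₁))).symm
  | .some x₁ y₁ h₁, .some x₂ y₂ h₂ =>
    by_cases hxy : x₁ = x₂ ∧ y₁ = (T • W).toAffine.negY x₂ y₂
    · rw [WeierstrassCurve.Affine.Point.add_of_Y_eq hxy.1 hxy.2]
      refine (WeierstrassCurve.Affine.Point.add_of_Y_eq (W := W.toAffine) ?_ ?_).symm
      · rw [hxy.1]
      · rw [negY_change, hxy.2, hxy.1]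
    · have hxy' : ¬(changeX T x₁ = changeX T x₂ ∧
          changeY T x₁ y₁ = W.toAffine.negY (changeX T x₂) (changeY T x₂ y₂)) := by
        rw [changeX_inj, negY_change]
        rintro ⟨rfl, h⟩
        exact hxy ⟨rfl, (changeY_inj T).mp h⟩
      rw [WeierstrassCurve.Affine.Point.add_some hxy]
      refine Eq.trans ?_ (WeierstrassCurve.Affine.Point.add_some (W := W.toAffine) hxy').symm
      obtain ⟨e₁, e₂, e₃, -, -⟩ := eq_of_variableChange T W
      have hX : changeX T ((T • W).toAffine.addX x₁ x₂ ((T • W).toAffine.slope x₁ x₂ y₁ y₂)) =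
          W.toAffine.addX (changeX T x₁) (changeX T x₂) (W.toAffine.slope (changeX T x₁)
            (changeX T x₂) (changeY T x₁ y₁) (changeY T x₂ y₂)) := by
        rw [slope_change T h₁.1 h₂.1 hxy]
        simp only [WeierstrassCurve.Affine.addX]
        rw [e₂, e₁, changeX, changeX, changeX]
        ring
      have hY : changeY T ((T • W).toAffine.addX x₁ x₂ ((T • W).toAffine.slope x₁ x₂ y₁ y₂))
          ((T • W).toAffine.addY x₁ x₂ y₁ ((T • W).toAffine.slope x₁ x₂ y₁ y₂)) =
          W.toAffine.addY (changeX T x₁) (changeX T x₂) (changeY T x₁ y₁)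
            (W.toAffine.slope (changeX T x₁) (changeX T x₂) (changeY T x₁ y₁)
            (changeY T x₂ y₂)) := by
        rw [WeierstrassCurve.Affine.addY, WeierstrassCurve.Affine.addY, ← negY_change,
          WeierstrassCurve.Affine.negAddY, WeierstrassCurve.Affine.negAddY, ← hX,
          slope_change T h₁.1 h₂.1 hxy]
        congr 1
        simp only [changeX, changeY]
        ring
      simp only [changePoint, WeierstrassCurve.Affine.Point.some.injEq]
      exact ⟨hX, hY⟩

end VariableChange

/-! ### Integral changes of variables -/

section Integrality

variable {L Γ : Type*} [Field L] [LinearOrderedCommGroupWithZero Γ] [hv : Valued L Γ]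

theorem isIntegralEq_iff {W : WeierstrassCurve L} : IsIntegralEq W ↔
    hv.v W.a₁ ≤ 1 ∧ hv.v W.a₂ ≤ 1 ∧ hv.v W.a₃ ≤ 1 ∧ hv.v W.a₄ ≤ 1 ∧ hv.v W.a₆ ≤ 1 := by
  constructor
  · rintro ⟨W₀, rfl⟩
    exact ⟨W₀.a₁.2, W₀.a₂.2, W₀.a₃.2, W₀.a₄.2, W₀.a₆.2⟩
  · rintro ⟨h₁, h₂, h₃, h₄, h₆⟩
    exact ⟨⟨⟨_, h₁⟩, ⟨_, h₂⟩, ⟨_, h₃⟩, ⟨_, h₄⟩, ⟨_, h₆⟩⟩, rfl⟩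

/-- A root of a quartic with integral coefficients and unit leading coefficient is integral. -/
theorem mem_integer_of_quartic {c x α β γ δ : L} (hc : hv.v c = 1) (hα : α ∈ 𝒪[L])
    (hβ : β ∈ 𝒪[L]) (hγ : γ ∈ 𝒪[L]) (hδ : δ ∈ 𝒪[L])
    (h : c * x ^ 4 = α * x ^ 3 + β * x ^ 2 + γ * x + δ) : x ∈ 𝒪[L] := by
  by_contra hx
  replace hx : 1 < hv.v x := not_le.mp hx
  have hx0 : (0 : Γ) < hv.v x := zero_lt_one.trans hx
  have hle : ∀ {a : L} {n : ℕ}, a ∈ 𝒪[L] → n ≤ 3 → hv.v (a * x ^ n) ≤ hv.v x ^ 3 := by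
    intro a n ha hn
    rw [map_mul, map_pow]
    exact (mul_le_of_le_one_left' ha).trans (pow_le_pow_right₀ hx.le hn)
  have hsum : hv.v (α * x ^ 3 + β * x ^ 2 + γ * x + δ) ≤ hv.v x ^ 3 := by
    refine hv.v.map_add_le (hv.v.map_add_le (hv.v.map_add_le (hle hα le_rfl)
      (hle hβ (by norm_num))) ?_) ?_
    · simpa using hle (n := 1) hγ (by norm_num)
    · simpa using hle (n := 0) hδ (by norm_num)
  rw [← h, map_mul, hc, one_mul, map_pow] at hsum
  exact (pow_lt_pow_right₀ hx (by norm_num : 3 < 4)).not_ge hsum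

theorem v_two_or_v_three : hv.v (2 : L) = 1 ∨ hv.v (3 : L) = 1 := by
  by_contra! h
  have h2 : hv.v (2 : L) < 1 := lt_of_le_of_ne (natCast_mem 𝒪[L] 2) h.1
  have h3 : hv.v (3 : L) < 1 := lt_of_le_of_ne (natCast_mem 𝒪[L] 3) h.2
  have h1 := hv.v.map_sub_lt h3 h2
  norm_num at h1

variable {W : WeierstrassCurve L} {T : WeierstrassCurve.VariableChange L}

/-- A change of variables between integral equations whose scaling is a unit is integral. The
equations for `b₆` and `b₈` make `r` a root of `4 X³ + ⋯` and of `3 X⁴ + ⋯`, and one of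
`4` and `3` is a unit. -/
theorem mem_integer_of_isIntegralEq (hu : hv.v (T.u : L) = 1) (hW : IsIntegralEq W)
    (hTW : IsIntegralEq (T • W)) : T.r ∈ 𝒪[L] ∧ T.s ∈ 𝒪[L] ∧ T.t ∈ 𝒪[L] := by
  obtain ⟨W₀, rfl⟩ := hW
  obtain ⟨W₁, hW₁⟩ := hTW
  set W := W₀.map (Valued.integer L).subtype with hWdef
  have hu' : (T.u : L) ∈ 𝒪[L] := hu.le
  have hn : ∀ n : ℕ, (n : L) ∈ 𝒪[L] := natCast_mem 𝒪[L]
  have hm : ∀ x : 𝒪[L], (Valued.integer L).subtype x ∈ 𝒪[L] := fun x => x.2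
  have hu0 : (T.u : L) ≠ 0 := T.u.ne_zero
  have hb₂ : W.b₂ ∈ 𝒪[L] := by rw [hWdef, WeierstrassCurve.map_b₂]; exact hm _
  have hb₄ : W.b₄ ∈ 𝒪[L] := by rw [hWdef, WeierstrassCurve.map_b₄]; exact hm _
  have hb₆ : W.b₆ ∈ 𝒪[L] := by rw [hWdef, WeierstrassCurve.map_b₆]; exact hm _
  have hb₈ : W.b₈ ∈ 𝒪[L] := by rw [hWdef, WeierstrassCurve.map_b₈]; exact hm _
  have hb₆' : (T • W).b₆ ∈ 𝒪[L] := by rw [← hW₁, WeierstrassCurve.map_b₆]; exact hm _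
  have hb₈' : (T • W).b₈ ∈ 𝒪[L] := by rw [← hW₁, WeierstrassCurve.map_b₈]; exact hm _
  have e₆ : T.u ^ 6 * (T • W).b₆ = W.b₆ + 2 * T.r * W.b₄ + T.r ^ 2 * W.b₂ + 4 * T.r ^ 3 := by
    rw [WeierstrassCurve.variableChange_b₆, Units.val_inv_eq_inv_val]
    field_simp
  have e₈ : T.u ^ 8 * (T • W).b₈ =
      W.b₈ + 3 * T.r * W.b₆ + 3 * T.r ^ 2 * W.b₄ + T.r ^ 3 * W.b₂ + 3 * T.r ^ 4 := by
    rw [WeierstrassCurve.variableChange_b₈, Units.val_inv_eq_inv_val]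
    field_simp
  have hr : T.r ∈ 𝒪[L] := by
    obtain h | h := v_two_or_v_three (L := L)
    · refine mem_integer_of_quartic (c := 4) (α := -W.b₂) (β := -(2 * W.b₄))
        (γ := T.u ^ 6 * (T • W).b₆ - W.b₆) (δ := 0) ?_ (neg_mem hb₂)
        (neg_mem (mul_mem (hn 2) hb₄)) (sub_mem (mul_mem (pow_mem hu' 6) hb₆') hb₆)
        (zero_mem _) ?_
      · rw [show (4 : L) = 2 ^ 2 by norm_num, map_pow, h, one_pow]
      · linear_combination (-T.r) * e₆
    · refine mem_integer_of_quartic (c := 3) (α := -W.b₂) (β := -(3 * W.b₄)) (γ := -(3 * W.b₆))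
        (δ := T.u ^ 8 * (T • W).b₈ - W.b₈) h (neg_mem hb₂)
        (neg_mem (mul_mem (hn 3) hb₄)) (neg_mem (mul_mem (hn 3) hb₆))
        (sub_mem (mul_mem (pow_mem hu' 8) hb₈') hb₈) ?_
      linear_combination -e₈
  obtain ⟨h₁, h₂, h₃, h₄, h₆⟩ := eq_of_variableChange T W
  have hs : T.s ∈ 𝒪[L] := by
    refine mem_integer_of_quartic (c := 1) (α := -W.a₁)
      (β := W.a₂ + 3 * T.r - T.u ^ 2 * (T • W).a₂) (γ := 0) (δ := 0) (map_one _)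
      (neg_mem (hm _)) (sub_mem (add_mem (hm _) (mul_mem (hn 3) hr))
      (mul_mem (pow_mem hu' 2) (hW₁ ▸ hm _))) (zero_mem _) (zero_mem _) ?_
    linear_combination (-T.s ^ 2) * h₂
  have ht : T.t ∈ 𝒪[L] := by
    refine mem_integer_of_quartic (c := 1) (α := -(W.a₃ + T.r * W.a₁))
      (β := W.a₆ - (T.u ^ 6 * (T • W).a₆ - T.r * W.a₄ - T.r ^ 2 * W.a₂ - T.r ^ 3)) (γ := 0)
      (δ := 0) (map_one _) (neg_mem (add_mem (hm _) (mul_mem hr (hm _))))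
      (sub_mem (hm _) (sub_mem (sub_mem (sub_mem (mul_mem (pow_mem hu' 6) (hW₁ ▸ hm _))
        (mul_mem hr (hm _))) (mul_mem (pow_mem hr 2) (hm _))) (pow_mem hr 3)))
      (zero_mem _) (zero_mem _) ?_
    linear_combination (-T.t ^ 2) * h₆
  exact ⟨hr, hs, ht⟩

theorem mem_integer_unit_mul_add_iff {c x y : L} (hc : hv.v c = 1) (hy : y ∈ 𝒪[L]) :
    c * x + y ∈ 𝒪[L] ↔ x ∈ 𝒪[L] := by
  have h : c * x ∈ 𝒪[L] ↔ x ∈ 𝒪[L] := by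
    change hv.v (c * x) ≤ 1 ↔ hv.v x ≤ 1
    rw [map_mul, hc, one_mul]
  rw [← h]
  exact ⟨fun hxy => by simpa using sub_mem hxy hy, fun hx => add_mem hx hy⟩

theorem hasSingularReduction_changePoint (hu : hv.v (T.u : L) = 1) (hr : T.r ∈ 𝒪[L])
    (hs : T.s ∈ 𝒪[L]) (ht : T.t ∈ 𝒪[L]) (P : (T • W).toAffine.Point) :
    HasSingularReduction W (changePoint T P) ↔ HasSingularReduction (T • W) P := by
  match P with
  | .zero => rfl
  | .some x y h =>
    have hu' : (T.u : L) ∈ 𝒪[L] := hu.le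
    have hp : ∀ n : ℕ, hv.v ((T.u : L) ^ n) = 1 := fun n => by rw [map_pow, hu, one_pow]
    simp only [HasSingularReduction, changePoint]
    have hx : hv.v (changeX T x) ≤ 1 ↔ hv.v x ≤ 1 := mem_integer_unit_mul_add_iff (hp 2) hr
    rw [hx]
    refine and_congr_right fun hx => ?_
    have hy : hv.v (changeY T x y) ≤ 1 ↔ hv.v y ≤ 1 := by
      rw [changeY, add_assoc]
      exact mem_integer_unit_mul_add_iff (hp 3)
        (add_mem (mul_mem (mul_mem (pow_mem hu' 2) hs) hx) ht)
    rw [hy]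
    refine and_congr_right fun hy => ?_
    rw [partialX_change T, partialY_change T, map_mul _ ((T.u : L) ^ 3), hp 3, one_mul,
      and_comm, and_comm (b := hv.v (2 * y + _ + _) < 1)]
    refine and_congr_right fun hY => ?_
    have hsY : hv.v (T.s * (T.u ^ 3 * (2 * y + (T • W).a₁ * x + (T • W).a₃))) < 1 := by
      rw [map_mul, map_mul, hp 3, one_mul]
      exact (mul_le_of_le_one_left' hs).trans_lt hY
    have hX : hv.v (T.u ^ 4 * ((T • W).a₁ * y - (3 * x ^ 2 + 2 * (T • W).a₂ * x + (T • W).a₄))) =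
        hv.v ((T • W).a₁ * y - (3 * x ^ 2 + 2 * (T • W).a₂ * x + (T • W).a₄)) := by
      rw [map_mul, hp 4, one_mul]
    rw [← hX]
    constructor
    · intro h
      simpa using hv.v.map_add_lt h hsY
    · intro h
      exact hv.v.map_sub_lt h hsY

/-! ### The index as a count of inequivalent points -/

open Classical in
/-- There are `n` points whose cosets of `E₀` are pairwise distinct: for any two of them, `P` and
`Q`, an equation `P + A = Q + B` holds with exactly one of `A`, `B` in `E₀`. -/
def HasCosets (W : WeierstrassCurve L) (n : ℕ) : Prop :=
  ∃ f : Fin n → W.toAffine.Point, ∀ i j, i ≠ j → ∃ A B : W.toAffine.Point,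
    ¬ HasSingularReduction W A ∧ HasSingularReduction W B ∧
      (f i + A = f j + B ∨ f j + A = f i + B)

open Classical in
theorem image_add_ne_iff (P Q : W.toAffine.Point) :
    (fun R => P + R) '' nonsingularReduction W ≠ (fun R => Q + R) '' nonsingularReduction W ↔
      ∃ A B : W.toAffine.Point, ¬ HasSingularReduction W A ∧ HasSingularReduction W B ∧
        (P + A = Q + B ∨ Q + A = P + B) := by
  have key : ∀ P Q : W.toAffine.Point, ¬ (fun R => P + R) '' nonsingularReduction W ⊆
      (fun R => Q + R) '' nonsingularReduction W ↔ ∃ A B : W.toAffine.Point,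
        ¬ HasSingularReduction W A ∧ HasSingularReduction W B ∧ P + A = Q + B := by
    intro P Q
    rw [Set.image_subset_iff, Set.not_subset]
    refine exists_congr fun A => ?_
    constructor
    · rintro ⟨hA, h⟩
      refine ⟨P + A - Q, hA, ?_, by abel⟩
      by_contra hB
      exact h ⟨_, hB, by dsimp only; abel⟩
    · rintro ⟨B, hA, hB, h⟩
      refine ⟨hA, ?_⟩
      rintro ⟨C, hC, hC'⟩
      obtain rfl : C = B := add_left_cancel (hC'.trans h)
      exact hC hB
  rw [Ne, Set.Subset.antisymm_iff, not_and_or, key, key]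
  simp only [and_or_left, exists_or]

theorem hasCosets_iff {n : ℕ} : HasCosets W n ↔ (n : ℕ∞) ≤
    open Classical in (Set.range fun P : W.toAffine.Point =>
      (fun Q => P + Q) '' nonsingularReduction W).encard := by
  classical
  simp only [HasCosets, ← image_add_ne_iff]
  constructor
  · rintro ⟨f, hf⟩
    have hinj : Function.Injective fun i => (fun R => f i + R) '' nonsingularReduction W := by
      intro i j h
      by_contra hij
      exact hf i j hij h
    calc (n : ℕ∞) = (Set.range fun i => (fun R => f i + R) '' nonsingularReduction W).encard := by
          rw [← Set.image_univ, hinj.encard_image, Set.encard_univ, ENat.card_eq_coe_fintype_card,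
            Fintype.card_fin]
      _ ≤ _ := by
          refine Set.encard_le_encard ?_
          rintro _ ⟨i, rfl⟩
          exact ⟨f i, rfl⟩
  · intro h
    obtain ⟨t, ht, htn⟩ := Set.exists_subset_encard_eq h
    have hfin : t.Finite := Set.finite_of_encard_eq_coe htn
    have := hfin.fintype
    have hcard : Fintype.card t = n := by
      rw [← Nat.cast_inj (R := ℕ∞), ← htn, Set.encard, ENat.card_eq_coe_fintype_card]
    let e : Fin n ≃ t := (Fintype.equivFinOfCardEq hcard).symm
    choose g hg using fun i : Fin n => ht (e i).2
    refine ⟨g, fun i j hij h => hij (e.injective (Subtype.ext ?_))⟩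
    rw [← hg i, ← hg j]
    exact h

theorem indexE₀_eq_iff {n : ℕ} (hn : 0 < n) :
    indexE₀ W = n ↔ HasCosets W n ∧ ¬ HasCosets W (n + 1) := by
  rw [hasCosets_iff, hasCosets_iff, indexE₀, Set.ncard_def,
    ENat.toNat_eq_iff hn.ne']
  generalize Set.encard _ = c
  rw [not_le]
  constructor
  · rintro rfl
    exact ⟨le_rfl, by exact_mod_cast n.lt_succ_self⟩
  · rintro ⟨h1, h2⟩
    refine le_antisymm ?_ h1
    rw [Nat.cast_add, Nat.cast_one] at h2
    exact Order.le_of_lt_add_one h2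

theorem HasCosets.of_variableChange (hu : hv.v (T.u : L) = 1) (hW : IsIntegralEq W)
    (hTW : IsIntegralEq (T • W)) {n : ℕ} (h : HasCosets (T • W) n) : HasCosets W n := by
  classical
  obtain ⟨hr, hs, ht⟩ := mem_integer_of_isIntegralEq hu hW hTW
  obtain ⟨f, hf⟩ := h
  refine ⟨fun i => changePoint T (f i), fun i j hij => ?_⟩
  obtain ⟨A, B, hA, hB, h⟩ := hf i j hij
  refine ⟨changePoint T A, changePoint T B,
    by rwa [hasSingularReduction_changePoint hu hr hs ht],
    by rwa [hasSingularReduction_changePoint hu hr hs ht], ?_⟩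
  have hadd := fun P Q => changePoint_add (W := W) T P Q
  refine h.imp (fun h => ?_) fun h => ?_
  · convert congrArg (changePoint T) h using 1 <;> convert (hadd _ _).symm
  · convert congrArg (changePoint T) h using 1 <;> convert (hadd _ _).symm

end Integrality

/-! ### Definability of the Tamagawa number -/

section Definability

variable {L : Type*} [Field L]

open Classical in
/-- The point of `W` encoded by `p`: the triple `(false, x, y)` stands for the affine point
`(x, y)` if this is a nonsingular point of `W`, and all other triples stand for the point at
infinity. -/
noncomputable def toPoint (W : WeierstrassCurve L) (p : Bool × L × L) : W.toAffine.Point :=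
  if h : p.1 = false ∧ W.toAffine.Nonsingular p.2.1 p.2.2 then .some _ _ h.2 else 0

variable {W : WeierstrassCurve L} {p q r : Bool × L × L}

theorem toPoint_surjective (W : WeierstrassCurve L) : Function.Surjective (toPoint W) := by
  rintro (_ | ⟨x, y, h⟩)
  · exact ⟨(true, 0, 0), by simp [toPoint, WeierstrassCurve.Affine.Point.zero_def]⟩
  · exact ⟨(false, x, y), dif_pos ⟨rfl, h⟩⟩

/-- The triple stands for an affine point. -/
def IsAffine (W : WeierstrassCurve L) (p : Bool × L × L) : Prop :=
  p.1 = false ∧ W.toAffine.Nonsingular p.2.1 p.2.2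

theorem toPoint_of_isAffine (h : IsAffine W p) : toPoint W p = .some _ _ h.2 := dif_pos h

theorem toPoint_of_not_isAffine (h : ¬ IsAffine W p) : toPoint W p = 0 := dif_neg h

theorem toPoint_eq_iff : toPoint W p = toPoint W q ↔
    (¬ IsAffine W p ∧ ¬ IsAffine W q) ∨ (IsAffine W p ∧ IsAffine W q ∧ p.2 = q.2) := by
  by_cases hp : IsAffine W p <;> by_cases hq : IsAffine W q <;>
    simp [hp, hq, toPoint_of_isAffine, toPoint_of_not_isAffine, Prod.ext_iff,
      WeierstrassCurve.Affine.Point.some_ne_zero,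
      (WeierstrassCurve.Affine.Point.some_ne_zero _).symm]

/-- `l` is the slope of the chord or tangent through the affine points `p` and `q`. -/
def IsSlope (W : WeierstrassCurve L) (p q : Bool × L × L) (l : L) : Prop :=
  (p.2.1 ≠ q.2.1 ∧ l * (p.2.1 - q.2.1) = p.2.2 - q.2.2) ∨
  (p.2.1 = q.2.1 ∧ p.2.2 ≠ W.toAffine.negY q.2.1 q.2.2 ∧
    l * (p.2.2 - W.toAffine.negY p.2.1 p.2.2) =
      3 * p.2.1 ^ 2 + 2 * W.a₂ * p.2.1 + W.a₄ - W.a₁ * p.2.2)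

theorem isSlope_iff [DecidableEq L] (hp : IsAffine W p) (hq : IsAffine W q) {l : L} :
    IsSlope W p q l ↔ ¬(p.2.1 = q.2.1 ∧ p.2.2 = W.toAffine.negY q.2.1 q.2.2) ∧
      l = W.toAffine.slope p.2.1 q.2.1 p.2.2 q.2.2 := by
  by_cases hx : p.2.1 = q.2.1
  · by_cases hy : p.2.2 = W.toAffine.negY q.2.1 q.2.2
    · simp [IsSlope, hx, hy]
    · have hy' : p.2.2 - W.toAffine.negY p.2.1 p.2.2 ≠ 0 := by
        have h := WeierstrassCurve.Affine.Y_eq_of_Y_ne hp.2.1 hq.2.1 hx hy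
        rw [sub_ne_zero]
        exact fun e => hy (by rw [← hx, ← h]; exact e)
      rw [WeierstrassCurve.Affine.slope_of_Y_ne hx hy, eq_div_iff hy']
      simp [IsSlope, hx]
  · rw [WeierstrassCurve.Affine.slope_of_X_ne hx, eq_div_iff (sub_ne_zero.mpr hx)]
    simp [IsSlope, hx]

open Classical in
/-- The graph of the addition of points, in terms of codes. -/
theorem toPoint_add_eq_iff : toPoint W p + toPoint W q = toPoint W r ↔
    (¬ IsAffine W p ∧ toPoint W q = toPoint W r) ∨ (¬ IsAffine W q ∧ toPoint W p = toPoint W r) ∨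
    (IsAffine W p ∧ IsAffine W q ∧ (p.2.1 = q.2.1 ∧ p.2.2 = W.toAffine.negY q.2.1 q.2.2) ∧
      ¬ IsAffine W r) ∨
    (IsAffine W p ∧ IsAffine W q ∧ IsAffine W r ∧ ∃ l, IsSlope W p q l ∧
      r.2.1 = W.toAffine.addX p.2.1 q.2.1 l ∧ r.2.2 = W.toAffine.addY p.2.1 q.2.1 p.2.2 l) := by
  by_cases hp : IsAffine W p
  swap
  · simp only [toPoint_of_not_isAffine hp, zero_add, hp, false_and, or_false, not_false_eq_true,
      true_and]
    by_cases hq : IsAffine W q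
    · simp [hq]
    · simp [hq, toPoint_of_not_isAffine hq]
  by_cases hq : IsAffine W q
  swap
  · simp [toPoint_of_not_isAffine hq, hq, hp]
  simp only [hp, hq, not_true_eq_false, false_and, false_or, true_and, isSlope_iff hp hq]
  rw [toPoint_of_isAffine hp, toPoint_of_isAffine hq]
  by_cases hxy : p.2.1 = q.2.1 ∧ p.2.2 = W.toAffine.negY q.2.1 q.2.2
  · rw [WeierstrassCurve.Affine.Point.add_of_Y_eq hxy.1 hxy.2]
    by_cases hr : IsAffine W r
    · simp [toPoint_of_isAffine hr, hr, hxy, (WeierstrassCurve.Affine.Point.some_ne_zero _).symm]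
    · simp [toPoint_of_not_isAffine hr, hr, hxy]
  · rw [WeierstrassCurve.Affine.Point.add_some hxy]
    by_cases hr : IsAffine W r
    · simp only [toPoint_of_isAffine hr, hr, hxy, WeierstrassCurve.Affine.Point.some.injEq,
        not_false_eq_true, true_and, false_and, false_or, exists_eq_left]
      exact and_congr eq_comm eq_comm
    · simp only [toPoint_of_not_isAffine hr, hr, hxy, WeierstrassCurve.Affine.Point.some_ne_zero,
        false_and, or_false]

variable [hv : Valued L ℤᵐ⁰]

theorem isClopen_setOf_mem_integer {Z : Type*} [TopologicalSpace Z] {f : Z → L}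
    (hf : Continuous f) : IsClopen {z | hv.v (f z) ≤ 1} := by
  have h := isClopen_setOf_v_le (L := L) one_ne_zero
  rw [map_one] at h
  exact h.preimage hf

theorem isClopen_setOf_v_lt_one {Z : Type*} [TopologicalSpace Z] {f : Z → L}
    (hf : Continuous f) : IsClopen {z | hv.v (f z) < 1} := by
  have h := isClopen_setOf_v_lt (1 : L)
  rw [map_one] at h
  exact h.preimage hf

theorem hasSingularReduction_toPoint_iff : HasSingularReduction W (toPoint W p) ↔
    IsAffine W p ∧ hv.v p.2.1 ≤ 1 ∧ hv.v p.2.2 ≤ 1 ∧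
      hv.v (W.a₁ * p.2.2 - (3 * p.2.1 ^ 2 + 2 * W.a₂ * p.2.1 + W.a₄)) < 1 ∧
      hv.v (2 * p.2.2 + W.a₁ * p.2.1 + W.a₃) < 1 := by
  by_cases hp : IsAffine W p
  · rw [toPoint_of_isAffine hp]
    simp [HasSingularReduction, hp]
  · rw [toPoint_of_not_isAffine hp]
    simp [HasSingularReduction, hp]

variable {Z : Type*} [TopologicalSpace Z] [LocallyCompactSpace Z] [SecondCountableTopology Z]

theorem isSigmaCompact_setOf_eq {X : Type*} [TopologicalSpace X] [T2Space X] {f g : Z → X}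
    (hf : Continuous f) (hg : Continuous g) : IsSigmaCompact {z | f z = g z} :=
  (isClosed_eq hf hg).isSigmaCompact'

variable [T2Space Z]

theorem isSigmaCompact_setOf_ne {X : Type*} [TopologicalSpace X] [T2Space X] {f g : Z → X}
    (hf : Continuous f) (hg : Continuous g) : IsSigmaCompact {z | f z ≠ g z} :=
  (isOpen_ne_fun hf hg).isSigmaCompact

variable [SecondCountableTopology L] {V : Z → WeierstrassCurve L} {a b c d : Z → Bool × L × L}

theorem isSigmaCompact_setOf_isAffine (hV : Continuous V) (ha : Continuous a) :
    IsSigmaCompact {z | IsAffine (V z) (a z)} := by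
  simp only [IsAffine, WeierstrassCurve.Affine.nonsingular_iff',
    WeierstrassCurve.Affine.equation_iff']
  exact .setOf_and (isSigmaCompact_setOf_eq (by fun_prop) (by fun_prop)) <|
    .setOf_and (isSigmaCompact_setOf_eq (by fun_prop) (by fun_prop)) <|
    .setOf_or (isSigmaCompact_setOf_ne (by fun_prop) (by fun_prop)) <|
    isSigmaCompact_setOf_ne (by fun_prop) (by fun_prop)

theorem isSigmaCompact_setOf_not_isAffine (hV : Continuous V) (ha : Continuous a) :
    IsSigmaCompact {z | ¬ IsAffine (V z) (a z)} := by
  simp only [IsAffine, WeierstrassCurve.Affine.nonsingular_iff',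
    WeierstrassCurve.Affine.equation_iff', not_and_or, not_or, not_not]
  exact .setOf_or (isSigmaCompact_setOf_ne (by fun_prop) (by fun_prop)) <|
    .setOf_or (isSigmaCompact_setOf_ne (by fun_prop) (by fun_prop)) <|
    .setOf_and (isSigmaCompact_setOf_eq (by fun_prop) (by fun_prop)) <|
    isSigmaCompact_setOf_eq (by fun_prop) (by fun_prop)

theorem isSigmaCompact_setOf_isSlope {l : Z → L} (hV : Continuous V) (ha : Continuous a)
    (hb : Continuous b) (hl : Continuous l) :
    IsSigmaCompact {z | IsSlope (V z) (a z) (b z) (l z)} := by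
  simp only [IsSlope, WeierstrassCurve.Affine.negY]
  exact .setOf_or (.setOf_and (isSigmaCompact_setOf_ne (by fun_prop) (by fun_prop))
      (isSigmaCompact_setOf_eq (by fun_prop) (by fun_prop))) <|
    .setOf_and (isSigmaCompact_setOf_eq (by fun_prop) (by fun_prop)) <|
    .setOf_and (isSigmaCompact_setOf_ne (by fun_prop) (by fun_prop)) <|
    isSigmaCompact_setOf_eq (by fun_prop) (by fun_prop)

theorem isSigmaCompact_setOf_toPoint_eq (hV : Continuous V) (ha : Continuous a)
    (hb : Continuous b) : IsSigmaCompact {z | toPoint (V z) (a z) = toPoint (V z) (b z)} := by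
  simp only [toPoint_eq_iff]
  exact .setOf_or (.setOf_and (isSigmaCompact_setOf_not_isAffine hV ha)
      (isSigmaCompact_setOf_not_isAffine hV hb)) <|
    .setOf_and (isSigmaCompact_setOf_isAffine hV ha) <|
    .setOf_and (isSigmaCompact_setOf_isAffine hV hb) <|
    isSigmaCompact_setOf_eq (by fun_prop) (by fun_prop)

theorem isSigmaCompact_setOf_hasSingularReduction (hV : Continuous V) (ha : Continuous a) :
    IsSigmaCompact {z | HasSingularReduction (V z) (toPoint (V z) (a z))} := by
  simp only [hasSingularReduction_toPoint_iff]
  exact .setOf_and (isSigmaCompact_setOf_isAffine hV ha) <|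
    .setOf_and (isClopen_setOf_mem_integer (by fun_prop)).isClosed.isSigmaCompact' <|
    .setOf_and (isClopen_setOf_mem_integer (by fun_prop)).isClosed.isSigmaCompact' <|
    .setOf_and (isClopen_setOf_v_lt_one (by fun_prop)).isClosed.isSigmaCompact'
    (isClopen_setOf_v_lt_one (by fun_prop)).isClosed.isSigmaCompact'

theorem isSigmaCompact_setOf_not_hasSingularReduction (hV : Continuous V) (ha : Continuous a) :
    IsSigmaCompact {z | ¬ HasSingularReduction (V z) (toPoint (V z) (a z))} := by
  simp only [hasSingularReduction_toPoint_iff, not_and_or]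
  exact .setOf_or (isSigmaCompact_setOf_not_isAffine hV ha) <|
    .setOf_or (isClopen_setOf_mem_integer (by fun_prop)).compl.isClosed.isSigmaCompact' <|
    .setOf_or (isClopen_setOf_mem_integer (by fun_prop)).compl.isClosed.isSigmaCompact' <|
    .setOf_or (isClopen_setOf_v_lt_one (by fun_prop)).compl.isClosed.isSigmaCompact'
    (isClopen_setOf_v_lt_one (by fun_prop)).compl.isClosed.isSigmaCompact'

variable [LocallyCompactSpace L]

open Classical in
theorem isSigmaCompact_setOf_toPoint_add_eq (hV : Continuous V) (ha : Continuous a)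
    (hb : Continuous b) (hc : Continuous c) :
    IsSigmaCompact {z | toPoint (V z) (a z) + toPoint (V z) (b z) = toPoint (V z) (c z)} := by
  simp only [toPoint_add_eq_iff]
  have hA := fun {a : Z → Bool × L × L} (ha : Continuous a) => isSigmaCompact_setOf_isAffine hV ha
  have hN := fun {a : Z → Bool × L × L} (ha : Continuous a) =>
    isSigmaCompact_setOf_not_isAffine hV ha
  refine .setOf_or ((hN ha).setOf_and (isSigmaCompact_setOf_toPoint_eq hV hb hc)) <|
    .setOf_or ((hN hb).setOf_and (isSigmaCompact_setOf_toPoint_eq hV ha hc)) <|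
    .setOf_or (.setOf_and (hA ha) <| .setOf_and (hA hb) <| .setOf_and (.setOf_and ?_ ?_) (hN hc)) <|
    .setOf_and (hA ha) <| .setOf_and (hA hb) <| .setOf_and (hA hc) <| .setOf_exists <|
    .setOf_and (isSigmaCompact_setOf_isSlope (by fun_prop) (by fun_prop) (by fun_prop)
      (by fun_prop)) <| .setOf_and ?_ ?_
  all_goals
    try simp only [WeierstrassCurve.Affine.addY, WeierstrassCurve.Affine.negAddY,
      WeierstrassCurve.Affine.addX, WeierstrassCurve.Affine.negY]
    exact isSigmaCompact_setOf_eq (by fun_prop) (by fun_prop)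

open Classical in
theorem isSigmaCompact_setOf_toPoint_add_eq_add (hV : Continuous V) (ha : Continuous a)
    (hb : Continuous b) (hc : Continuous c) (hd : Continuous d) :
    IsSigmaCompact {z | toPoint (V z) (a z) + toPoint (V z) (b z) =
      toPoint (V z) (c z) + toPoint (V z) (d z)} := by
  have h : {z | toPoint (V z) (a z) + toPoint (V z) (b z) =
      toPoint (V z) (c z) + toPoint (V z) (d z)} = {z | ∃ p,
      toPoint (V z) (a z) + toPoint (V z) (b z) = toPoint (V z) p ∧
      toPoint (V z) (c z) + toPoint (V z) (d z) = toPoint (V z) p} := by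
    ext z
    constructor
    · intro h
      obtain ⟨p, hp⟩ := toPoint_surjective (V z) (toPoint (V z) (a z) + toPoint (V z) (b z))
      exact ⟨p, hp.symm, h.symm.trans hp.symm⟩
    · rintro ⟨p, h, h'⟩
      exact h.trans h'.symm
  rw [h]
  exact .setOf_exists (.setOf_and
    (isSigmaCompact_setOf_toPoint_add_eq (by fun_prop) (by fun_prop) (by fun_prop) (by fun_prop))
    (isSigmaCompact_setOf_toPoint_add_eq (by fun_prop) (by fun_prop) (by fun_prop) (by fun_prop)))

theorem isSigmaCompact_setOf_hasCosets (n : ℕ) :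
    IsSigmaCompact {W : WeierstrassCurve L | HasCosets W n} := by
  classical
  have h : ∀ W : WeierstrassCurve L, HasCosets W n ↔ ∃ g : Fin n → Bool × L × L,
      ∀ x : {x : Fin n × Fin n // x.1 ≠ x.2}, ∃ y : (Bool × L × L) × (Bool × L × L),
        ¬ HasSingularReduction W (toPoint W y.1) ∧ HasSingularReduction W (toPoint W y.2) ∧
        (toPoint W (g x.1.1) + toPoint W y.1 = toPoint W (g x.1.2) + toPoint W y.2 ∨
          toPoint W (g x.1.2) + toPoint W y.1 = toPoint W (g x.1.1) + toPoint W y.2) := by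
    intro W
    have hs := toPoint_surjective W
    constructor
    · rintro ⟨f, hf⟩
      choose g hg using fun i => hs (f i)
      refine ⟨g, fun ⟨⟨i, j⟩, hij⟩ => ?_⟩
      obtain ⟨A, B, h⟩ := hf i j hij
      obtain ⟨a, rfl⟩ := hs A
      obtain ⟨b, rfl⟩ := hs B
      exact ⟨(a, b), by simpa only [hg] using h⟩
    · rintro ⟨g, hg⟩
      refine ⟨fun i => toPoint W (g i), fun i j hij => ?_⟩
      obtain ⟨y, hy⟩ := hg ⟨(i, j), hij⟩
      exact ⟨_, _, hy⟩
  simp only [h]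
  exact .setOf_exists <| .setOf_forall fun x => .setOf_exists <|
    .setOf_and (isSigmaCompact_setOf_not_hasSingularReduction (by fun_prop) (by fun_prop)) <|
    .setOf_and (isSigmaCompact_setOf_hasSingularReduction (by fun_prop) (by fun_prop)) <|
    .setOf_or (isSigmaCompact_setOf_toPoint_add_eq_add (by fun_prop) (by fun_prop) (by fun_prop)
      (by fun_prop) (by fun_prop)) <|
    isSigmaCompact_setOf_toPoint_add_eq_add (by fun_prop) (by fun_prop) (by fun_prop)
      (by fun_prop) (by fun_prop)

end Definability

section Tamagawa

variable {L : Type*} [Field L]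

theorem HasTamagawaNumber.of_variableChange {Γ : Type*} [LinearOrderedCommGroupWithZero Γ]
    [Valued L Γ] {W : WeierstrassCurve L} {n : ℕ} (h : HasTamagawaNumber W n)
    (T : WeierstrassCurve.VariableChange L) : HasTamagawaNumber (T • W) n := by
  obtain ⟨S, hS, hn⟩ := h
  refine ⟨S * T⁻¹, ?_, ?_⟩ <;> rwa [mul_smul, inv_smul_smul]

variable [hv : Valued L ℤᵐ⁰]

theorem isClosed_setOf_v_eq (c : ℤᵐ⁰) : IsClosed {x : L | hv.v x = c} := by
  by_cases h : ∃ y, hv.v y = c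
  · obtain ⟨y, rfl⟩ := h
    obtain rfl | hy := eq_or_ne y 0
    · simp
    · exact (isClopen_setOf_v_eq hy).isClosed
  · convert isClosed_empty
    exact Set.eq_empty_of_forall_notMem fun x hx => h ⟨x, hx⟩

/-- The integral equations with discriminant of valuation `c`. -/
def integralEqSet (L : Type*) [Field L] [hv : Valued L ℤᵐ⁰] (c : ℤᵐ⁰) :
    Set (WeierstrassCurve L) :=
  {W | IsIntegralEq W ∧ hv.v W.Δ = c}

/-- The Tamagawa number is `n` if, for the largest valuation `c` of the discriminant of an
equivalent integral equation, one such equation has at least `n` cosets and none has `n + 1`. The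
negated conditions speak of all equations with that valuation, which have equally many cosets, so
that every condition, or its negation, is existential. -/
theorem hasTamagawaNumber_iff {W : WeierstrassCurve L} (hΔ : W.Δ ≠ 0) {n : ℕ} (hn : 0 < n) :
    HasTamagawaNumber W n ↔ ∃ c : ℤᵐ⁰,
      (¬ ∃ c' : Set.Ioi c, ∃ T : WeierstrassCurve.VariableChange L,
        T • W ∈ integralEqSet L c') ∧
      (∃ T : WeierstrassCurve.VariableChange L,
        T • W ∈ integralEqSet L c ∩ {V | HasCosets V n}) ∧
      ¬ ∃ T : WeierstrassCurve.VariableChange L,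
        T • W ∈ integralEqSet L c ∩ {V | HasCosets V (n + 1)} := by
  constructor
  · rintro ⟨T, ⟨hT, hmin⟩, hidx⟩
    rw [indexE₀_eq_iff hn] at hidx
    have htrans : ∀ S : WeierstrassCurve.VariableChange L, S • W = (S * T⁻¹) • T • W := fun S => by
      rw [mul_smul, inv_smul_smul]
    refine ⟨hv.v (T • W).Δ, ?_, ⟨T, ⟨hT, rfl⟩, hidx.1⟩, ?_⟩
    · rintro ⟨⟨c', hc'⟩, S, hS, hSc⟩
      refine not_le_of_gt (Set.mem_Ioi.mp hc') ?_
      rw [htrans S] at hS hSc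
      have hle := hmin _ hS
      rwa [hSc] at hle
    · rintro ⟨S, ⟨hS, hSc⟩, hcos⟩
      rw [htrans S] at hS hSc
      rw [Set.mem_ofPred_eq, htrans S] at hcos
      refine hidx.2 (hcos.of_variableChange ?_ hT hS)
      generalize S * T⁻¹ = U at hSc
      have hTΔ : (T • W).Δ ≠ 0 := by
        rw [WeierstrassCurve.variableChange_Δ]
        exact mul_ne_zero (pow_ne_zero _ (Units.ne_zero _)) hΔ
      rw [WeierstrassCurve.variableChange_Δ, map_mul, map_pow, Units.val_inv_eq_inv_val, map_inv₀,
        mul_eq_right₀ (by simpa using hTΔ)] at hSc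
      exact inv_eq_one.mp ((pow_eq_one_iff.mp hSc).resolve_right (by norm_num))
  · rintro ⟨c, hmax, ⟨T, ⟨hT, hTc⟩, hcos⟩, hcos'⟩
    refine ⟨T, ⟨hT, fun S hS => ?_⟩, ?_⟩
    · by_contra! hlt
      rw [hTc] at hlt
      exact hmax ⟨⟨_, hlt⟩, S * T, by rw [mul_smul]; exact ⟨hS, rfl⟩⟩
    · rw [indexE₀_eq_iff hn]
      exact ⟨hcos, fun h => hcos' ⟨T, ⟨hT, hTc⟩, h⟩⟩

variable [LocallyCompactSpace L] [SecondCountableTopology L]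

theorem isSigmaCompact_setOf_exists_variableChange {s : Set (WeierstrassCurve L)}
    (hs : IsSigmaCompact s) :
    IsSigmaCompact {W : WeierstrassCurve L | ∃ T : WeierstrassCurve.VariableChange L,
      T • W ∈ s} := by
  -- The parameters are `u⁻¹`, `r`, `s`, `t`, so that the transformed coefficients are polynomials.
  let g : WeierstrassCurve L × (L × L × L × L) → WeierstrassCurve L := fun x =>
    { a₁ := x.2.1 * (x.1.a₁ + 2 * x.2.2.2.1)
      a₂ := x.2.1 ^ 2 * (x.1.a₂ - x.2.2.2.1 * x.1.a₁ + 3 * x.2.2.1 - x.2.2.2.1 ^ 2)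
      a₃ := x.2.1 ^ 3 * (x.1.a₃ + x.2.2.1 * x.1.a₁ + 2 * x.2.2.2.2)
      a₄ := x.2.1 ^ 4 * (x.1.a₄ - x.2.2.2.1 * x.1.a₃ + 2 * x.2.2.1 * x.1.a₂
        - (x.2.2.2.2 + x.2.2.1 * x.2.2.2.1) * x.1.a₁ + 3 * x.2.2.1 ^ 2
        - 2 * x.2.2.2.1 * x.2.2.2.2)
      a₆ := x.2.1 ^ 6 * (x.1.a₆ + x.2.2.1 * x.1.a₄ + x.2.2.1 ^ 2 * x.1.a₂ + x.2.2.1 ^ 3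
        - x.2.2.2.2 * x.1.a₃ - x.2.2.2.2 ^ 2 - x.2.2.1 * x.2.2.2.2 * x.1.a₁) }
  have hg : Continuous g := by
    apply continuous_weierstrassCurve <;> simp only [g] <;> fun_prop
  have h : {W : WeierstrassCurve L | ∃ T : WeierstrassCurve.VariableChange L, T • W ∈ s} =
      {W | ∃ y : L × L × L × L, y.1 ≠ 0 ∧ g (W, y) ∈ s} := by
    ext W
    constructor
    · rintro ⟨T, hT⟩
      exact ⟨(((T.u⁻¹ : Lˣ) : L), T.r, T.s, T.t), (T.u⁻¹).ne_zero, hT⟩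
    · rintro ⟨⟨u, r, s, t⟩, hu, hT⟩
      exact ⟨⟨(Units.mk0 u hu)⁻¹, r, s, t⟩, by
        simpa only [WeierstrassCurve.variableChange_def, inv_inv, Units.val_mk0] using hT⟩
  rw [h]
  exact .setOf_exists <| .setOf_and (isSigmaCompact_setOf_ne (by fun_prop) (by fun_prop))
    (hs.preimage' hg)

theorem isSigmaCompact_integralEqSet (c : ℤᵐ⁰) : IsSigmaCompact (integralEqSet L c) := by
  simp only [integralEqSet, isIntegralEq_iff]
  refine IsClosed.isSigmaCompact' (IsClosed.inter ?_ ?_)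
  · have h := fun {f : WeierstrassCurve L → L} (hf : Continuous f) =>
      (isClopen_setOf_mem_integer hf).isClosed
    exact (h (by fun_prop)).inter <| (h (by fun_prop)).inter <| (h (by fun_prop)).inter <|
      (h (by fun_prop)).inter (h (by fun_prop))
  · exact (isClosed_setOf_v_eq c).preimage (by fun_prop)

/-- The elliptic curves with a given positive Tamagawa number form a Borel set. -/
theorem measurableSet_setOf_hasTamagawaNumber [MeasurableSpace L] [BorelSpace L] {n : ℕ}
    (hn : 0 < n) :
    MeasurableSet {a : Fin 5 → L | (ofCoeffs a).Δ ≠ 0 ∧ HasTamagawaNumber (ofCoeffs a) n} := by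
  have hΔ : MeasurableSet {a : Fin 5 → L | (ofCoeffs a).Δ ≠ 0} :=
    (isOpen_ne_fun (by fun_prop) continuous_const).measurableSet
  have hm : ∀ {s : Set (WeierstrassCurve L)}, IsSigmaCompact s →
      MeasurableSet {a : Fin 5 → L | ofCoeffs a ∈ s} := fun hs =>
    (hs.preimage' continuous_ofCoeffs).measurableSet
  have hE := fun c : ℤᵐ⁰ => isSigmaCompact_setOf_exists_variableChange
    (isSigmaCompact_integralEqSet (L := L) c)
  have hN := fun (c : ℤᵐ⁰) (n : ℕ) => isSigmaCompact_setOf_exists_variableChange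
    ((isSigmaCompact_integralEqSet (L := L) c).setOf_and (isSigmaCompact_setOf_hasCosets n))
  have h : {a : Fin 5 → L | (ofCoeffs a).Δ ≠ 0 ∧ HasTamagawaNumber (ofCoeffs a) n} =
      {a | (ofCoeffs a).Δ ≠ 0} ∩ ⋃ c : ℤᵐ⁰, (⋃ c' : Set.Ioi c,
        {a | ofCoeffs a ∈ {W : WeierstrassCurve L | ∃ T : WeierstrassCurve.VariableChange L,
          T • W ∈ integralEqSet L c'}})ᶜ ∩
        ({a | ofCoeffs a ∈ {W : WeierstrassCurve L | ∃ T : WeierstrassCurve.VariableChange L,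
          T • W ∈ integralEqSet L c ∩ {V | HasCosets V n}}} ∩
        {a | ofCoeffs a ∈ {W : WeierstrassCurve L | ∃ T : WeierstrassCurve.VariableChange L,
          T • W ∈ integralEqSet L c ∩ {V | HasCosets V (n + 1)}}}ᶜ) := by
    ext a
    refine and_congr_right fun ha => ?_
    simp only [hasTamagawaNumber_iff ha hn, Set.mem_iUnion, Set.mem_inter_iff, Set.mem_compl_iff,
      Set.mem_ofPred_eq]
  rw [h]
  exact hΔ.inter (.iUnion fun c => (MeasurableSet.iUnion fun c' : Set.Ioi c => hm (hE c')).compl.inter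
    ((hm (hN c n)).inter (hm (hN c (n + 1))).compl))

/-- The set of curves with given Kodaira type, Tamagawa number and number of iterations is
measurable: Kodaira type and number of iterations cut out a sigma-compact set. -/
theorem measurableSet_curveSet [CompactSpace 𝒪[L]] [MeasurableSpace L] [BorelSpace L]
    {π : 𝒪[L]} (hπ : π ≠ 0) (r : KodairaType) {n : ℕ} (hn : 0 < n) (k : ℕ) :
    MeasurableSet (curveSet π r n k) := by
  have hι : Continuous fun (W : WeierstrassCurve 𝒪[L]) (i : Fin 5) => ((coeffs W i : 𝒪[L]) : L) :=
    continuous_pi fun i => continuous_subtype_val.comp (continuous_coeffs_apply i)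
  have h : curveSet π r n k = ((fun (W : WeierstrassCurve 𝒪[L]) (i : Fin 5) =>
      ((coeffs W i : 𝒪[L]) : L)) '' {W | TateOutput π W r k}) ∩
      {a : Fin 5 → L | (ofCoeffs a).Δ ≠ 0 ∧ HasTamagawaNumber (ofCoeffs a) n} := by
    have hc : ∀ W : WeierstrassCurve 𝒪[L], (fun i => ((coeffs W i : 𝒪[L]) : L)) =
        ![(W.a₁ : L), (W.a₂ : L), (W.a₃ : L), (W.a₄ : L), (W.a₆ : L)] := fun W => by
      ext i
      fin_cases i <;> rfl
    have hΔ : ∀ W : WeierstrassCurve 𝒪[L],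
        (W.map (Valued.integer L).subtype).Δ ≠ 0 ↔ W.Δ ≠ 0 := fun W => by
      rw [WeierstrassCurve.map_Δ, Ne, Subring.coe_subtype, Subring.coe_eq_zero_iff]
    ext a
    constructor
    · rintro ⟨W, rfl, hW, hk, ht⟩
      exact ⟨⟨W, hk, hc W⟩, (hΔ W).mpr hW, ht⟩
    · rintro ⟨⟨W, hk, rfl⟩, hW, ht⟩
      exact ⟨W, hc W, (hΔ W).mp hW, hk, ht⟩
  rw [h]
  exact ((isSigmaCompact_setOf_tateOutput hπ r k).image hι).measurableSet.inter
    (measurableSet_setOf_hasTamagawaNumber hn)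

end Tamagawa

/-! ### Haar measure on the space of coefficient vectors -/

open MeasureTheory

section HaarMeasure

variable {L : Type*} [Field L] [hv : Valued L ℤᵐ⁰]

/-- The integral vectors with a given residue class of the `j`-th coordinate. -/
def residueClass (j : Fin 5) (c : 𝓀[L]) : Set (Fin 5 → L) :=
  {a | ∃ h : ∀ i, a i ∈ 𝒪[L], IsLocalRing.residue 𝒪[L] ⟨a j, h j⟩ = c}

theorem iUnion_residueClass (j : Fin 5) :
    ⋃ c : 𝓀[L], residueClass j c = {a : Fin 5 → L | ∀ i, a i ∈ 𝒪[L]} := by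
  ext a
  simp [residueClass]

theorem pairwise_disjoint_residueClass (j : Fin 5) :
    Pairwise (Function.onFun Disjoint (residueClass (L := L) j)) := by
  intro c d hcd
  rw [Function.onFun, Set.disjoint_left]
  rintro a ⟨h, hc⟩ ⟨h', hd⟩
  exact hcd (hc.symm.trans hd)

theorem mem_residueClass_zero_iff {j : Fin 5} {a : Fin 5 → L} :
    a ∈ residueClass j 0 ↔ (∀ i, a i ∈ 𝒪[L]) ∧ hv.v (a j) < 1 := by
  rw [residueClass, Set.mem_ofPred_eq, ← exists_prop]
  refine exists_congr fun h => ?_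
  rw [IsLocalRing.residue_eq_zero_iff, IsLocalRing.mem_maximalIdeal, mem_nonunits_iff,
    Valuation.Integers.isUnit_iff_valuation_eq_one (Valuation.integer.integers hv.v)]
  exact (lt_iff_le_and_ne.trans (and_iff_right (h j))).symm

/-- The residue classes are translates of one another. -/
theorem preimage_add_residueClass (j : Fin 5) (x : 𝒪[L]) :
    (fun a => Pi.single j (x : L) + a) ⁻¹' residueClass j (IsLocalRing.residue 𝒪[L] x) =
      residueClass j 0 := by
  have hx : ∀ i, (Pi.single j (x : L) : Fin 5 → L) i ∈ 𝒪[L] := by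
    intro i
    obtain rfl | hij := eq_or_ne i j
    · simp
    · simp [hij]
  ext a
  constructor
  · rintro ⟨h, hc⟩
    have ha : ∀ i, a i ∈ 𝒪[L] := fun i => by simpa using sub_mem (h i) (hx i)
    refine ⟨ha, ?_⟩
    rw [← sub_eq_zero, ← map_sub] at hc
    rw [← hc]
    congr 1
    ext
    simp
  · rintro ⟨h, hc⟩
    refine ⟨fun i => add_mem (hx i) (h i), ?_⟩
    rw [← sub_eq_zero, ← map_sub, ← hc]
    congr 1
    ext
    simp

variable [MeasurableSpace L] [BorelSpace L]

theorem measurableSet_residueClass (j : Fin 5) (c : 𝓀[L]) : MeasurableSet (residueClass j c) := by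
  obtain ⟨x, rfl⟩ := IsLocalRing.residue_surjective c
  have h0 : MeasurableSet (residueClass (L := L) j 0) := by
    have h : residueClass (L := L) j 0 =
        (⋂ i, {a : Fin 5 → L | hv.v (a i) ≤ 1}) ∩ {a | hv.v (a j) < 1} := by
      ext a
      simp only [mem_residueClass_zero_iff, Set.mem_inter_iff, Set.mem_iInter]
      rfl
    rw [h]
    refine .inter (.iInter fun i => ?_) ?_
    · exact (isClopen_setOf_mem_integer (L := L) continuous_id).isOpen.measurableSet.preimage
        (measurable_pi_apply i)
    · exact (isClopen_setOf_v_lt_one (L := L) continuous_id).isOpen.measurableSet.preimage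
        (measurable_pi_apply j)
  have h1 : (fun a => Pi.single j (-(x : L)) + a) ⁻¹' residueClass j 0 =
      residueClass j (IsLocalRing.residue 𝒪[L] x) := by
    rw [← preimage_add_residueClass j x, ← Set.preimage_comp]
    convert Set.preimage_id
    ext a i
    simp [← add_assoc, Pi.single_neg]
  rw [← h1]
  exact h0.preimage (measurable_const_add _)

variable (μ : Measure (Fin 5 → L)) [μ.IsAddHaarMeasure]

theorem measure_residueClass (j : Fin 5) (c : 𝓀[L]) :
    μ (residueClass j c) = μ (residueClass j 0) := by
  obtain ⟨x, rfl⟩ := IsLocalRing.residue_surjective c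
  rw [← preimage_add_residueClass j x, measure_preimage_add]

/-- The residue field is finite because the integral vectors have finite measure. -/
theorem finite_residueField_of_measure_ne_top
    (hμ : μ {a : Fin 5 → L | ∀ i, a i ∈ 𝒪[L]} ≠ ∞) : Finite 𝓀[L] := by
  by_contra hinf
  rw [not_finite_iff_infinite] at hinf
  have hopen : IsOpen (residueClass (L := L) 0 0) := by
    have h : residueClass (L := L) 0 0 =
        (⋂ i, {a : Fin 5 → L | hv.v (a i) ≤ 1}) ∩ {a | hv.v (a 0) < 1} := by
      ext a
      simp only [mem_residueClass_zero_iff, Set.mem_inter_iff, Set.mem_iInter]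
      rfl
    rw [h]
    exact (isOpen_iInter_of_finite fun i =>
      (isClopen_setOf_mem_integer (continuous_apply i)).isOpen).inter
      (isClopen_setOf_v_lt_one (continuous_apply 0)).isOpen
  have hpos : μ (residueClass (L := L) 0 0) ≠ 0 :=
    (hopen.measure_pos μ ⟨0, mem_residueClass_zero_iff.mpr ⟨fun _ => zero_mem _, by simp⟩⟩).ne'
  let f := Infinite.natEmbedding 𝓀[L]
  have hsum : μ (⋃ n, residueClass 0 (f n)) = ∞ := by
    rw [measure_iUnion (f := fun n => residueClass 0 (f n))
      (fun m n hmn => pairwise_disjoint_residueClass 0 (f.injective.ne hmn))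
      fun n => measurableSet_residueClass 0 (f n)]
    simp only [measure_residueClass μ 0 (f _)]
    exact ENNReal.tsum_const_eq_top_of_ne_zero hpos
  refine hμ (top_unique (hsum.symm.le.trans (measure_mono ?_)))
  rw [← iUnion_residueClass 0]
  exact Set.iUnion_subset fun n => Set.subset_iUnion _ (f n)

theorem card_mul_measure_residueClass [Finite 𝓀[L]]
    (hμ : μ {a : Fin 5 → L | ∀ i, a i ∈ 𝒪[L]} = 1)
    (j : Fin 5) :
    (Nat.card 𝓀[L] : ℝ≥0∞) * μ (residueClass j 0) = 1 := by
  have := Fintype.ofFinite 𝓀[L]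
  rw [← hμ, ← iUnion_residueClass j, measure_iUnion (pairwise_disjoint_residueClass j)
    (measurableSet_residueClass j)]
  simp only [measure_residueClass μ j, tsum_fintype, Finset.sum_const, Finset.card_univ,
    Nat.card_eq_fintype_card, nsmul_eq_mul]

/-- Coordinatewise multiplication by units, as an automorphism of `L⁵`. -/
def diagEquiv (c : Fin 5 → Lˣ) : (Fin 5 → L) ≃ₜ+ (Fin 5 → L) where
  toFun a i := c i * a i
  invFun a i := (c i)⁻¹ * a i
  left_inv a := by ext i; simp
  right_inv a := by ext i; simp
  map_add' a b := by ext i; simp [mul_add]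
  continuous_toFun := by fun_prop
  continuous_invFun := by fun_prop

variable [LocallyCompactSpace L] [SecondCountableTopology L]

theorem measure_preimage_of_addEquiv (φ : (Fin 5 → L) ≃ₜ+ (Fin 5 → L)) {q : ℝ≥0∞}
    (hμ : μ {a : Fin 5 → L | ∀ i, a i ∈ 𝒪[L]} = 1)
    (hφ : μ (φ ⁻¹' {a | ∀ i, a i ∈ 𝒪[L]}) = q) (S : Set (Fin 5 → L)) :
    μ (φ ⁻¹' S) = q * μ S := by
  have h := fun X : Set (Fin 5 → L) => addEquivAddHaarChar_smul_preimage μ (X := X) φ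
  have h1 := h {a | ∀ i, a i ∈ 𝒪[L]}
  rw [hμ, hφ, ENNReal.smul_def, smul_eq_mul, mul_comm] at h1
  rw [← h S, ENNReal.smul_def, smul_eq_mul, ← mul_assoc, h1, one_mul]

theorem measure_preimage_diagEquiv_single [Finite 𝓀[L]]
    (hμ : μ {a : Fin 5 → L | ∀ i, a i ∈ 𝒪[L]} = 1)
    {ϖ : Lˣ} (hϖ : ∀ x : L, hv.v x < 1 ↔ hv.v (ϖ⁻¹ * x) ≤ 1) (j : Fin 5)
    (S : Set (Fin 5 → L)) :
    μ (diagEquiv (Pi.mulSingle j ϖ⁻¹) ⁻¹' S) = (Nat.card 𝓀[L] : ℝ≥0∞)⁻¹ * μ S := by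
  refine measure_preimage_of_addEquiv μ _ hμ ?_ S
  have h : diagEquiv (Pi.mulSingle j ϖ⁻¹) ⁻¹' {a : Fin 5 → L | ∀ i, a i ∈ 𝒪[L]} =
      residueClass j 0 := by
    ext a
    rw [mem_residueClass_zero_iff, hϖ]
    constructor
    · intro h
      have hj : ((Pi.mulSingle j ϖ⁻¹ : Fin 5 → Lˣ) j : L) * a j ∈ 𝒪[L] := h j
      rw [Pi.mulSingle_eq_same] at hj
      refine ⟨fun i => ?_, hj⟩
      obtain rfl | hij := eq_or_ne i j
      · exact ((hϖ _).mpr hj).le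
      · simpa [diagEquiv, hij] using h i
    · rintro ⟨h, hj⟩ i
      obtain rfl | hij := eq_or_ne i j
      · change ((Pi.mulSingle i ϖ⁻¹ : Fin 5 → Lˣ) i : L) * a i ∈ 𝒪[L]
        rwa [Pi.mulSingle_eq_same]
      · simpa [diagEquiv, hij] using h i
  rw [h]
  exact ENNReal.eq_inv_of_mul_eq_one_left (by rw [mul_comm, card_mul_measure_residueClass μ hμ j])

theorem measure_preimage_diagEquiv_pow [Finite 𝓀[L]]
    (hμ : μ {a : Fin 5 → L | ∀ i, a i ∈ 𝒪[L]} = 1)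
    {ϖ : Lˣ} (hϖ : ∀ x : L, hv.v x < 1 ↔ hv.v (ϖ⁻¹ * x) ≤ 1) (e : Fin 5 → ℕ)
    (S : Set (Fin 5 → L)) :
    μ (diagEquiv (fun i => (ϖ ^ e i)⁻¹) ⁻¹' S) =
      (Nat.card 𝓀[L] : ℝ≥0∞)⁻¹ ^ (∑ i, e i) * μ S := by
  have hmul : ∀ (c d : Fin 5 → Lˣ) (S : Set (Fin 5 → L)),
      diagEquiv (c * d) ⁻¹' S = diagEquiv c ⁻¹' (diagEquiv d ⁻¹' S) := by
    intro c d S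
    rw [← Set.preimage_comp]
    congr 1
    ext a i
    simp [diagEquiv, mul_comm, mul_left_comm]
  have hpow : ∀ (j : Fin 5) (m : ℕ) (S : Set (Fin 5 → L)),
      μ (diagEquiv (Pi.mulSingle j (ϖ ^ m)⁻¹) ⁻¹' S) =
        (Nat.card 𝓀[L] : ℝ≥0∞)⁻¹ ^ m * μ S := by
    intro j m
    induction m with
    | zero =>
      intro S
      have h1 : diagEquiv (1 : Fin 5 → Lˣ) ⁻¹' S = S := by
        ext a
        simp [diagEquiv]
      simp [h1]
    | succ m ih =>
      intro S
      rw [pow_succ, mul_inv_rev, Pi.mulSingle_mul, hmul,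
        measure_preimage_diagEquiv_single μ hμ hϖ, ih, pow_succ, mul_left_comm, mul_assoc]
  have hprod : ∀ (t : Finset (Fin 5)) (S : Set (Fin 5 → L)),
      μ (diagEquiv (∏ j ∈ t, Pi.mulSingle j (ϖ ^ e j)⁻¹) ⁻¹' S) =
        (Nat.card 𝓀[L] : ℝ≥0∞)⁻¹ ^ (∑ i ∈ t, e i) * μ S := by
    intro t
    induction t using Finset.induction_on with
    | empty => simpa using fun S => hpow 0 0 S
    | insert j t hj ih =>
      intro S
      rw [Finset.prod_insert hj, Finset.sum_insert hj, hmul, hpow, ih, pow_add, mul_assoc]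
  rw [← hprod Finset.univ S, Finset.univ_prod_mulSingle]

end HaarMeasure

/-! ### Translates and rescalings over the valuation ring -/

section Rescaling

variable {L : Type*} [Field L] [hv : Valued L ℤᵐ⁰] {π : 𝒪[L]}

/-- The change of variables `(x, y) ↦ (c ^ 2 x, c ^ 3 y)`, which replaces `aᵢ` with `aᵢ / c ^ i`. -/
def scaling (c : Lˣ) : WeierstrassCurve.VariableChange L := ⟨c, 0, 0, 0⟩

/-- The equation over `L` given by an equation over the valuation ring. -/
abbrev toField (W : WeierstrassCurve 𝒪[L]) : WeierstrassCurve L := W.map (Valued.integer L).subtype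

/-- The change of variables over `L` given by one over the valuation ring. -/
abbrev changeToField (T : WeierstrassCurve.VariableChange 𝒪[L]) :
    WeierstrassCurve.VariableChange L := T.map (Valued.integer L).subtype

theorem toField_injective : Function.Injective (toField (L := L)) :=
  WeierstrassCurve.map_injective Subtype.val_injective

theorem changeToField_mul (S T : WeierstrassCurve.VariableChange 𝒪[L]) :
    changeToField (S * T) = changeToField S * changeToField T :=
  map_mul (WeierstrassCurve.VariableChange.mapHom (Valued.integer L).subtype) S T

theorem changeToField_inv (T : WeierstrassCurve.VariableChange 𝒪[L]) :
    changeToField T⁻¹ = (changeToField T)⁻¹ :=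
  map_inv (WeierstrassCurve.VariableChange.mapHom (Valued.integer L).subtype) T

theorem toField_smul (T : WeierstrassCurve.VariableChange 𝒪[L]) (W : WeierstrassCurve 𝒪[L]) :
    toField (T • W) = changeToField T • toField W :=
  (WeierstrassCurve.map_variableChange W T _).symm

theorem isRescaling_iff {c : Lˣ} (hc : (c : L) = π) {V V' : WeierstrassCurve 𝒪[L]} :
    IsRescaling π V V' ↔ scaling c • toField V = toField V' := by
  have hc0 : (π : L) ≠ 0 := hc ▸ c.ne_zero
  have h : ∀ (m : ℕ) (x y : 𝒪[L]), x = π ^ m * y ↔ ((π : L)⁻¹) ^ m * (x : L) = y := by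
    intro m x y
    rw [inv_pow, inv_mul_eq_iff_eq_mul₀ (pow_ne_zero _ hc0), Subtype.ext_iff]
    rfl
  have h1 := h 1 V.a₁ V'.a₁
  simp only [pow_one] at h1
  rw [IsRescaling, h1, h 2, h 3, h 4, h 6, WeierstrassCurve.ext_iff]
  simp [scaling, WeierstrassCurve.variableChange_def, hc]

/-- An equation over `L` whose rescaling is integral is divisible accordingly. -/
theorem exists_isRescaling {c : Lˣ} (hc : (c : L) = π) {X : WeierstrassCurve L}
    {V' : WeierstrassCurve 𝒪[L]} (h : scaling c • X = toField V') :
    ∃ V, toField V = X ∧ IsRescaling π V V' := by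
  have hV : IsRescaling π ⟨π * V'.a₁, π ^ 2 * V'.a₂, π ^ 3 * V'.a₃, π ^ 4 * V'.a₄, π ^ 6 * V'.a₆⟩
    V' := ⟨rfl, rfl, rfl, rfl, rfl⟩
  refine ⟨_, ?_, hV⟩
  rw [isRescaling_iff hc, ← h] at hV
  exact MulAction.injective _ hV

/-- Translations of the rescaled equation come from translations by multiples of `π²`, `π`, `π³`
of the original equation. -/
theorem IsRescaling.smul {c : Lˣ} (hc : (c : L) = π) {V V' : WeierstrassCurve 𝒪[L]}
    (h : IsRescaling π V V') (ρ σ τ : 𝒪[L]) :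
    IsRescaling π ((⟨1, π ^ 2 * ρ, π * σ, π ^ 3 * τ⟩ : WeierstrassCurve.VariableChange 𝒪[L]) • V)
      ((⟨1, ρ, σ, τ⟩ : WeierstrassCurve.VariableChange 𝒪[L]) • V') := by
  rw [isRescaling_iff hc] at h ⊢
  rw [toField_smul, toField_smul, ← h, smul_smul, smul_smul]
  congr 1
  ext <;> simp [scaling, WeierstrassCurve.VariableChange.mul_def, hc] <;> ring

/-- If an equation and a translate of it can both be rescaled, then the translation is by multiples
of `π²`, `π`, `π³`, because isomorphic integral equations with the same discriminant are related by
an integral change of variables. -/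
theorem dvd_of_isRescaling {c : Lˣ} (hc : (c : L) = π) {V V' V'' : WeierstrassCurve 𝒪[L]}
    {T : WeierstrassCurve.VariableChange 𝒪[L]} (hT : T.u = 1) (h : IsRescaling π V V')
    (h' : IsRescaling π (T • V) V'') : π ^ 2 ∣ T.r ∧ π ∣ T.s ∧ π ^ 3 ∣ T.t := by
  have hc0 : (π : L) ≠ 0 := hc ▸ c.ne_zero
  rw [isRescaling_iff hc] at h h'
  rw [toField_smul] at h'
  have hS : (scaling c * changeToField T * (scaling c)⁻¹) • toField V' = toField V'' := by
    rw [← h, ← h', mul_smul, inv_smul_smul, mul_smul]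
  have hu : hv.v ((scaling c * changeToField T * (scaling c)⁻¹).u : L) = 1 := by
    simp [scaling, WeierstrassCurve.VariableChange.mul_def, WeierstrassCurve.VariableChange.inv_def,
      hT]
  obtain ⟨hr, hs, ht⟩ := mem_integer_of_isIntegralEq hu ⟨V', rfl⟩ (hS ▸ ⟨V'', rfl⟩)
  refine ⟨⟨⟨_, hr⟩, ?_⟩, ⟨⟨_, hs⟩, ?_⟩, ⟨⟨_, ht⟩, ?_⟩⟩ <;> apply Subtype.ext <;>
    simp [scaling, WeierstrassCurve.VariableChange.mul_def,
      WeierstrassCurve.VariableChange.inv_def, hc] <;> field_simp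

/-- The elliptic curves with Kodaira type `r`, Tamagawa number `n` and exactly `k` completed
iterations, as equations over the valuation ring. -/
def curveClass (π : 𝒪[L]) (r : KodairaType) (n k : ℕ) : Set (WeierstrassCurve 𝒪[L]) :=
  {W | W.Δ ≠ 0 ∧ TateOutput π W r k ∧ HasTamagawaNumber (toField W) n}

theorem coeffs_toField_mem_curveSet_iff {r : KodairaType} {n k : ℕ} {X : WeierstrassCurve L} :
    coeffs X ∈ curveSet π r n k ↔ ∃ W ∈ curveClass π r n k, toField W = X := by
  constructor
  · rintro ⟨W, hX, hW⟩
    refine ⟨W, hW, ?_⟩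
    rw [← ofCoeffs_coeffs X, hX]
    rfl
  · rintro ⟨W, hW, rfl⟩
    exact ⟨W, rfl, hW⟩

theorem smul_mem_curveClass {r : KodairaType} {n k : ℕ} {W : WeierstrassCurve 𝒪[L]}
    (hW : W ∈ curveClass π r n k) {T : WeierstrassCurve.VariableChange 𝒪[L]} (hT : T.u = 1) :
    T • W ∈ curveClass π r n k := by
  obtain ⟨hΔ, hk, ht⟩ := hW
  have h : IsTranslate W (T • W) := ⟨T, hT, rfl⟩
  refine ⟨by rwa [h.Δ_eq], hk.of_isTranslate h, ?_⟩
  rw [toField_smul]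
  exact ht.of_variableChange _

theorem mem_curveClass_succ_iff (hπ : ¬ IsUnit π) {c : Lˣ} (hc : (c : L) = π) {r : KodairaType}
    {n k : ℕ} {W : WeierstrassCurve 𝒪[L]} :
    W ∈ curveClass π r n (k + 1) ↔ ∃ (T : WeierstrassCurve.VariableChange 𝒪[L])
      (V : WeierstrassCurve 𝒪[L]), T.u = 1 ∧ IsRescaling π (T • W) V ∧ V ∈ curveClass π r n k := by
  have hπ0 : π ≠ 0 := by
    rintro rfl
    exact c.ne_zero hc
  constructor
  · rintro ⟨hΔ, hk, ht⟩
    obtain ⟨_, V, ⟨T, hT, rfl⟩, hV, hk⟩ := (tateOutput_succ_iff hπ).mp hk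
    refine ⟨T, V, hT, hV, fun h0 => hΔ ?_, hk, ?_⟩
    · rw [← (show IsTranslate W (T • W) from ⟨T, hT, rfl⟩).Δ_eq, hV.Δ_eq, h0, mul_zero]
    · rw [← (isRescaling_iff hc).mp hV, toField_smul]
      exact (ht.of_variableChange _).of_variableChange _
  · rintro ⟨T, V, hT, hV, hΔ, hk, ht⟩
    have h : IsTranslate W (T • W) := ⟨T, hT, rfl⟩
    refine ⟨?_, (tateOutput_succ_iff hπ).mpr ⟨_, V, h, hV, hk⟩, ?_⟩
    · rw [← h.Δ_eq, hV.Δ_eq]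
      exact mul_ne_zero (pow_ne_zero _ hπ0) hΔ
    · rw [← (isRescaling_iff hc).mp hV, toField_smul] at ht
      simpa only [inv_smul_smul] using
        (ht.of_variableChange (scaling c)⁻¹).of_variableChange (changeToField T)⁻¹

/-- Representatives of the translations modulo those by multiples of `π²`, `π`, `π³`. -/
noncomputable def translationRep (i : (𝒪[L] ⧸ Ideal.span {π} ^ 2) × (𝒪[L] ⧸ Ideal.span {π} ^ 1) ×
    (𝒪[L] ⧸ Ideal.span {π} ^ 3)) : WeierstrassCurve.VariableChange 𝒪[L] :=
  ⟨1, Quotient.out i.1, Quotient.out i.2.1, Quotient.out i.2.2⟩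

theorem mk_eq_mk_iff_dvd {m : ℕ} {x y : 𝒪[L]} :
    Ideal.Quotient.mk (Ideal.span {π} ^ m) x = Ideal.Quotient.mk (Ideal.span {π} ^ m) y ↔
      π ^ m ∣ x - y := by
  rw [Ideal.Quotient.mk_eq_mk_iff_sub_mem, Ideal.span_singleton_pow, Ideal.mem_span_singleton]

theorem mk_out {I : Ideal 𝒪[L]} (x : 𝒪[L] ⧸ I) : Ideal.Quotient.mk I (Quotient.out x) = x :=
  Quotient.out_eq x

theorem exists_translationRep (T : WeierstrassCurve.VariableChange 𝒪[L]) (hT : T.u = 1) :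
    ∃ i ρ σ τ, translationRep (π := π) i = ⟨1, π ^ 2 * ρ, π * σ, π ^ 3 * τ⟩ * T := by
  obtain ⟨u, r, s, t⟩ := T
  obtain rfl : u = 1 := hT
  obtain ⟨ρ, hρ⟩ := mk_eq_mk_iff_dvd.mp (mk_out (Ideal.Quotient.mk (Ideal.span {π} ^ 2) r))
  obtain ⟨σ, hσ⟩ := mk_eq_mk_iff_dvd.mp (mk_out (Ideal.Quotient.mk (Ideal.span {π} ^ 1) s))
  obtain ⟨τ, hτ⟩ := mk_eq_mk_iff_dvd.mp
    (mk_out (Ideal.Quotient.mk (Ideal.span {π} ^ 3) (t + π ^ 2 * ρ * s)))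
  refine ⟨⟨Ideal.Quotient.mk _ r, Ideal.Quotient.mk _ s, Ideal.Quotient.mk _ (t + π ^ 2 * ρ * s)⟩,
    ρ, σ, τ, ?_⟩
  rw [sub_eq_iff_eq_add] at hρ hσ hτ
  simp only [translationRep, WeierstrassCurve.VariableChange.mul_def, Units.val_one, one_pow,
    mul_one, one_mul]
  rw [hρ, hσ, hτ, pow_one, add_comm t, add_assoc]

theorem translationRep_inj {i j : (𝒪[L] ⧸ Ideal.span {π} ^ 2) × (𝒪[L] ⧸ Ideal.span {π} ^ 1) ×
    (𝒪[L] ⧸ Ideal.span {π} ^ 3)} {T : WeierstrassCurve.VariableChange 𝒪[L]}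
    (hT : π ^ 2 ∣ T.r ∧ π ∣ T.s ∧ π ^ 3 ∣ T.t) (h : translationRep j = T * translationRep i) :
    i = j := by
  obtain ⟨i₁, i₂, i₃⟩ := i
  obtain ⟨j₁, j₂, j₃⟩ := j
  obtain ⟨u, r, s, t⟩ := T
  obtain ⟨hr, hs, ht⟩ := hT
  simp only [translationRep, WeierstrassCurve.VariableChange.mul_def,
    WeierstrassCurve.VariableChange.mk.injEq, Units.val_one, one_pow, mul_one, one_mul] at h
  obtain ⟨-, h₁, h₂, h₃⟩ := h
  have e₁ : j₁ = i₁ := by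
    rw [← mk_out j₁, ← mk_out i₁, mk_eq_mk_iff_dvd, h₁, add_sub_cancel_right]
    exact hr
  have e₂ : j₂ = i₂ := by
    rw [← mk_out j₂, ← mk_out i₂, mk_eq_mk_iff_dvd, h₂, add_sub_cancel_right, pow_one]
    exact hs
  -- The representatives of equal classes are equal, so the remaining translation has `r = 0`.
  have hr0 : r = 0 := by simpa [e₁] using h₁
  have e₃ : j₃ = i₃ := by
    rw [← mk_out j₃, ← mk_out i₃, mk_eq_mk_iff_dvd, h₃, hr0, zero_mul, add_zero,
      add_sub_cancel_right]
    exact ht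
  rw [e₁, e₂, e₃]

/-- A curve that completes `k + 1` iterations is carried to one that completes `k` by a
representative translation and the rescaling. -/
theorem curveSet_succ (hπ : ¬ IsUnit π) {c : Lˣ} (hc : (c : L) = π) (r : KodairaType) (n k : ℕ) :
    curveSet π r n (k + 1) = ⋃ i, (fun a => coeffs (scaling c •
      changeToField (translationRep (π := π) i) • ofCoeffs a)) ⁻¹' curveSet π r n k := by
  ext a
  obtain ⟨X, rfl⟩ : ∃ X, a = coeffs X := ⟨ofCoeffs a, (coeffs_ofCoeffs a).symm⟩
  simp only [Set.mem_iUnion, Set.mem_preimage, coeffs_toField_mem_curveSet_iff, ofCoeffs_coeffs]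
  constructor
  · rintro ⟨W, hW, rfl⟩
    obtain ⟨T, V, hT, hV, hVk⟩ := (mem_curveClass_succ_iff hπ hc).mp hW
    obtain ⟨i, ρ, σ, τ, hi⟩ := exists_translationRep (π := π) T hT
    refine ⟨i, _, smul_mem_curveClass hVk (T := ⟨1, ρ, σ, τ⟩) rfl, ?_⟩
    rw [← (isRescaling_iff hc).mp (hV.smul hc ρ σ τ), smul_smul, ← hi, toField_smul]
  · rintro ⟨i, V', hV', hX⟩
    obtain ⟨V, hV, hVV'⟩ := exists_isRescaling hc hX.symm
    refine ⟨(translationRep i)⁻¹ • V, (mem_curveClass_succ_iff hπ hc).mpr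
      ⟨translationRep i, V', rfl, by rwa [smul_inv_smul], hV'⟩, ?_⟩
    rw [toField_smul, hV, changeToField_inv, inv_smul_smul]

/-- The representative translation is determined by the curve. -/
theorem pairwise_disjoint_preimage_curveSet {c : Lˣ} (hc : (c : L) = π) (r : KodairaType)
    (n k : ℕ) :
    Pairwise (Function.onFun Disjoint fun i => (fun a => coeffs (scaling c •
      changeToField (translationRep (π := π) i) • ofCoeffs a)) ⁻¹' curveSet π r n k) := by
  intro i j hij
  rw [Function.onFun, Set.disjoint_left]
  intro a hi hj
  rw [Set.mem_preimage, coeffs_toField_mem_curveSet_iff] at hi hj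
  obtain ⟨V', -, hV'⟩ := hi
  obtain ⟨U', -, hU'⟩ := hj
  obtain ⟨V, hV, hVV'⟩ := exists_isRescaling hc hV'.symm
  obtain ⟨U, hU, hUU'⟩ := exists_isRescaling hc hU'.symm
  have hUV : (translationRep j * (translationRep i)⁻¹) • V = U := by
    apply toField_injective
    rw [toField_smul, changeToField_mul, changeToField_inv, hV, hU, mul_smul, inv_smul_smul]
  refine hij (translationRep_inj (dvd_of_isRescaling hc ?_ hVV' (hUV ▸ hUU'))
    (inv_mul_cancel_right _ _).symm)
  simp [translationRep, WeierstrassCurve.VariableChange.mul_def,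
    WeierstrassCurve.VariableChange.inv_def]

end Rescaling

/-! ### The effect of one iteration on the measure -/

section Iteration

open MeasureTheory

variable {L : Type*} [Field L]

/-- The linear part of the action of the change of variables `(1, r, s, t)` on coefficient
vectors. -/
def translateLinear (r s t : L) (a : Fin 5 → L) : Fin 5 → L :=
  ![a 0, a 1 - s * a 0, a 2 + r * a 0, a 3 - s * a 2 + 2 * r * a 1 - (t + r * s) * a 0,
    a 4 + r * a 3 + r ^ 2 * a 1 - t * a 2 - r * t * a 0]

/-- Translations act on coefficient vectors by affine maps. -/
theorem coeffs_smul_ofCoeffs {T : WeierstrassCurve.VariableChange L} (hT : T.u = 1)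
    (a : Fin 5 → L) :
    coeffs (T • ofCoeffs a) = coeffs (T • ofCoeffs 0) + translateLinear T.r T.s T.t a := by
  ext i
  fin_cases i <;> simp [coeffs, ofCoeffs, translateLinear, WeierstrassCurve.variableChange_def, hT]
    <;> ring

theorem translateLinear_translateLinear (r s t : L) (a : Fin 5 → L) :
    translateLinear (-r) (-s) (r * s - t) (translateLinear r s t a) = a := by
  ext i
  fin_cases i <;> simp [translateLinear] <;> ring

variable [hv : Valued L ℤᵐ⁰]

/-- The linear part of the action of `(1, r, s, t)`, as an automorphism of `L⁵`. -/
def translateEquiv (r s t : L) : (Fin 5 → L) ≃ₜ+ (Fin 5 → L) where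
  toFun := translateLinear r s t
  invFun := translateLinear (-r) (-s) (r * s - t)
  left_inv := translateLinear_translateLinear r s t
  right_inv a := by
    convert translateLinear_translateLinear (-r) (-s) (r * s - t) a using 2 <;> ring
  map_add' a b := by
    ext i
    fin_cases i <;> simp [translateLinear] <;> ring
  continuous_toFun := by
    refine continuous_pi fun i => ?_
    fin_cases i <;> simp [translateLinear] <;> fun_prop
  continuous_invFun := by
    refine continuous_pi fun i => ?_
    fin_cases i <;> simp [translateLinear] <;> fun_prop

theorem translateLinear_mem {r s t : L} (hr : r ∈ 𝒪[L]) (hs : s ∈ 𝒪[L]) (ht : t ∈ 𝒪[L])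
    {a : Fin 5 → L} (ha : ∀ i, a i ∈ 𝒪[L]) (i : Fin 5) : translateLinear r s t a i ∈ 𝒪[L] := by
  lift r to 𝒪[L] using hr
  lift s to 𝒪[L] using hs
  lift t to 𝒪[L] using ht
  lift a to Fin 5 → 𝒪[L] using ha
  have h : ∀ x : 𝒪[L], (x : L) ∈ 𝒪[L] := fun x => x.2
  fin_cases i
  · exact h (a 0)
  · exact h (a 1 - s * a 0)
  · exact h (a 2 + r * a 0)
  · exact h (a 3 - s * a 2 + 2 * r * a 1 - (t + r * s) * a 0)
  · exact h (a 4 + r * a 3 + r ^ 2 * a 1 - t * a 2 - r * t * a 0)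

theorem coeffs_scaling_smul (c : Lˣ) (X : WeierstrassCurve L) :
    coeffs (scaling c • X) = diagEquiv (fun i => (c ^ (![1, 2, 3, 4, 6] i))⁻¹) (coeffs X) := by
  ext i
  fin_cases i <;> simp [coeffs, scaling, diagEquiv, WeierstrassCurve.variableChange_def]

theorem v_lt_one_iff [IsDiscreteValuationRing 𝒪[L]] {π : 𝒪[L]} (hπ : Irreducible π) {c : Lˣ}
    (hc : (c : L) = π) (x : L) :
    hv.v x < 1 ↔ hv.v (((c⁻¹ : Lˣ) : L) * x) ≤ 1 := by
  have hint := Valuation.integer.integers hv.v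
  constructor
  · intro hx
    have hm : (⟨x, hx.le⟩ : 𝒪[L]) ∈ IsLocalRing.maximalIdeal 𝒪[L] := by
      rw [IsLocalRing.mem_maximalIdeal, mem_nonunits_iff, hint.isUnit_iff_valuation_eq_one]
      exact hx.ne
    rw [hπ.maximalIdeal_eq, Ideal.mem_span_singleton] at hm
    obtain ⟨y, hy⟩ := hm
    have hxy : x = c * y := by rw [hc]; exact congrArg Subtype.val hy
    rw [hxy, Units.inv_mul_cancel_left]
    exact y.2
  · intro hx
    have hπ1 : hv.v (c : L) < 1 := by
      refine lt_of_le_of_ne (hc ▸ π.2) fun h => hπ.not_isUnit ?_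
      rw [hint.isUnit_iff_valuation_eq_one]
      rw [hc] at h
      exact h
    rw [← Units.mul_inv_cancel_left c x, map_mul]
    exact mul_lt_one_of_lt_of_le hπ1 hx

theorem card_quotient_span_pow [IsDiscreteValuationRing 𝒪[L]] {π : 𝒪[L]} (hπ : Irreducible π)
    (m : ℕ) :
    Nat.card (𝒪[L] ⧸ Ideal.span {π} ^ m) = Nat.card 𝓀[L] ^ m := by
  rw [← hπ.maximalIdeal_eq]
  exact cardQuot_pow_of_prime (IsDiscreteValuationRing.not_a_field 𝒪[L])

variable [LocallyCompactSpace L] [SecondCountableTopology L] [MeasurableSpace L] [BorelSpace L]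
  (μ : Measure (Fin 5 → L)) [μ.IsAddHaarMeasure]

/-- Integral translations preserve the measure. -/
theorem measure_preimage_smul (hμ : μ {a : Fin 5 → L | ∀ i, a i ∈ 𝒪[L]} = 1)
    {T : WeierstrassCurve.VariableChange 𝒪[L]} (hT : T.u = 1) (S : Set (Fin 5 → L)) :
    μ ((fun a => coeffs (changeToField T • ofCoeffs a)) ⁻¹' S) = μ S := by
  have hT' : (changeToField T).u = 1 := by simp [hT]
  have h : (fun a => coeffs (changeToField T • ofCoeffs a)) ⁻¹' S =
      translateEquiv (T.r : L) T.s T.t ⁻¹'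
        ((fun b => coeffs (changeToField T • ofCoeffs 0) + b) ⁻¹' S) := by
    ext a
    rw [Set.mem_preimage, coeffs_smul_ofCoeffs hT']
    rfl
  have hO : translateEquiv (T.r : L) T.s T.t ⁻¹' {a | ∀ i, a i ∈ 𝒪[L]} =
      {a | ∀ i, a i ∈ 𝒪[L]} := by
    ext a
    refine ⟨fun ha => ?_, fun ha => translateLinear_mem T.r.2 T.s.2 T.t.2 ha⟩
    have h := translateLinear_mem (neg_mem T.r.2) (neg_mem T.s.2)
      (sub_mem (mul_mem T.r.2 T.s.2) T.t.2) ha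
    exact translateLinear_translateLinear (T.r : L) T.s T.t a ▸ h
  rw [h, measure_preimage_of_addEquiv μ _ hμ (by rw [hO, hμ]), one_mul, measure_preimage_add]

variable [IsDiscreteValuationRing 𝒪[L]] [Finite 𝓀[L]] [CompactSpace 𝒪[L]] {π : 𝒪[L]}

/-- One iteration is undone by `Q ^ 6` classes of translations, each of which contributes a copy
of the set scaled by `Q ^ (-16)`, where `16 = 1 + 2 + 3 + 4 + 6`. -/
theorem measure_curveSet_succ (hμ : μ {a : Fin 5 → L | ∀ i, a i ∈ 𝒪[L]} = 1)
    (hπ : Irreducible π) (r : KodairaType) {n : ℕ} (hn : 0 < n) (k : ℕ) :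
    μ (curveSet π r n (k + 1)) =
      ((Nat.card 𝓀[L] : ℝ≥0∞) ^ 10)⁻¹ * μ (curveSet π r n k) := by
  obtain ⟨c, hc⟩ : ∃ c : Lˣ, (c : L) = π :=
    ⟨Units.mk0 (π : L) (by simpa using hπ.ne_zero), rfl⟩
  have hQ : Nat.card 𝓀[L] ≠ 0 := Nat.card_pos.ne'
  have hfin : ∀ m, Finite (𝒪[L] ⧸ Ideal.span {π} ^ m) := fun m =>
    Nat.finite_of_card_ne_zero (by rw [card_quotient_span_pow hπ]; exact pow_ne_zero _ hQ)
  have := hfin 1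
  have := hfin 2
  have := hfin 3
  have hm := measurableSet_curveSet hπ.ne_zero r hn k
  have hmeas : ∀ i, MeasurableSet ((fun a => coeffs (scaling c •
      changeToField (translationRep (π := π) i) • ofCoeffs a)) ⁻¹' curveSet π r n k) := by
    intro i
    refine Continuous.measurable ?_ hm
    have h := funext fun a => coeffs_smul_ofCoeffs
      (T := changeToField (translationRep (π := π) i)) (by simp [translationRep]) a
    simp only [coeffs_scaling_smul]
    refine (diagEquiv _).continuous.comp ?_
    rw [h]
    exact continuous_const.add (translateEquiv (L := L) _ _ _).continuous
  have hone : ∀ i, μ ((fun a => coeffs (scaling c •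
      changeToField (translationRep (π := π) i) • ofCoeffs a)) ⁻¹' curveSet π r n k) =
      (Nat.card 𝓀[L] : ℝ≥0∞)⁻¹ ^ 16 * μ (curveSet π r n k) := by
    intro i
    simp only [coeffs_scaling_smul]
    refine (measure_preimage_smul μ hμ (T := translationRep (π := π) i) rfl
      (diagEquiv (fun i => (c ^ (![1, 2, 3, 4, 6] i))⁻¹) ⁻¹' curveSet π r n k)).trans ?_
    rw [measure_preimage_diagEquiv_pow μ hμ (v_lt_one_iff hπ hc)]
    congr 1
  have := Fintype.ofFinite ((𝒪[L] ⧸ Ideal.span {π} ^ 2) × (𝒪[L] ⧸ Ideal.span {π} ^ 1) ×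
    (𝒪[L] ⧸ Ideal.span {π} ^ 3))
  rw [curveSet_succ hπ.not_isUnit hc,
    measure_iUnion (pairwise_disjoint_preimage_curveSet hc r n k) hmeas]
  simp only [hone, tsum_fintype, Finset.sum_const, Finset.card_univ, ← Nat.card_eq_fintype_card,
    Nat.card_prod, card_quotient_span_pow hπ, nsmul_eq_mul]
  rw [← mul_assoc]
  congr 1
  have h0 : (Nat.card 𝓀[L] : ℝ≥0∞) ≠ 0 := by exact_mod_cast hQ
  have ht : (Nat.card 𝓀[L] : ℝ≥0∞) ≠ ∞ := ENNReal.natCast_ne_top _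
  push_cast
  rw [ENNReal.inv_pow, show 16 = 6 + 10 from rfl, pow_add, ← mul_assoc,
    show ∀ x : ℝ≥0∞, x ^ 2 * (x ^ 1 * x ^ 3) = x ^ 6 from fun x => by ring, ← mul_pow,
    ENNReal.mul_inv_cancel h0 ht, one_pow, one_mul]

theorem measure_curveSet (hμ : μ {a : Fin 5 → L | ∀ i, a i ∈ 𝒪[L]} = 1)
    (hπ : Irreducible π) (r : KodairaType) {n : ℕ} (hn : 0 < n) (k : ℕ) :
    μ (curveSet π r n k) =
      1 / (Nat.card 𝓀[L] : ℝ≥0∞) ^ (10 * k) * μ (curveSet π r n 0) := by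
  induction k with
  | zero => simp
  | succ k ih =>
    rw [measure_curveSet_succ μ hμ hπ r hn, ih, ← mul_assoc, one_div, one_div, ENNReal.inv_pow,
      ENNReal.inv_pow, ENNReal.inv_pow, ← pow_add, mul_add_one, add_comm]

end Iteration

/-! ### Completions of discretely valued fields -/

theorem isNontrivial_completion {K : Type*} [Field K] {v : Valuation K ℤᵐ⁰}
    (hv : Function.Surjective v) : (Valued.v : Valuation v.Completion ℤᵐ⁰).IsNontrivial := by
  obtain ⟨x, hx⟩ := hv (WithZero.exp 1)
  have h : Valued.v (((WithVal.equiv v).symm x : WithVal v) : v.Completion) = WithZero.exp 1 := by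
    rw [Valued.valuedCompletion_apply, ← hx]
    rfl
  refine ⟨_, h.trans_ne WithZero.exp_ne_zero, h.trans_ne fun h1 => ?_⟩
  rw [← WithZero.exp_zero] at h1
  exact one_ne_zero (WithZero.exp_injective h1)

end TateAlg

theorem theorem1p1 {F K : Type*} [Field F] [Finite F] [Field K] [Algebra (RatFunc F) K]
    [FunctionField F K]
    (v : Valuation K ℤᵐ⁰) (hv : Function.Surjective v)
    [MeasurableSpace v.Completion] [BorelSpace v.Completion]
    (μ : MeasureTheory.Measure (Fin 5 → v.Completion)) [μ.IsAddHaarMeasure]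
    (hμ : μ {a | ∀ i, a i ∈ 𝒪[v.Completion]} = 1)
    (π : 𝒪[v.Completion]) (hπ : Irreducible π)
    (r : KodairaType) (n : ℕ) (hn : 0 < n) :
    (∀ k : ℕ, MeasurableSet (TateAlg.curveSet π r n k)) ∧
      ∀ k : ℕ, μ (TateAlg.curveSet π r n k) =
        1 / (Nat.card 𝓀[v.Completion] : ℝ≥0∞) ^ (10 * k) * μ (TateAlg.curveSet π r n 0) := by
  have := TateAlg.isNontrivial_completion hv
  have := TateAlg.isDiscreteValuationRing_integer (L := v.Completion)
  have := TateAlg.finite_residueField_of_measure_ne_top μ (hμ ▸ ENNReal.one_ne_top)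
  obtain ⟨_, _, _⟩ := TateAlg.locallyCompact_of_finite_residueField (L := v.Completion)
  exact ⟨TateAlg.measurableSet_curveSet hπ.ne_zero r hn, TateAlg.measure_curveSet μ hμ hπ r hn⟩
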